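/- There are absolute constants $C,c>0$ such that the following holds. Let $(x,y)\sim\mathcal D$ be a random pair with $x$ in a separable real Hilbert space and $y\in\mathbb R$, with $\mathbb E\|x\|^4<\infty$ and $\mathbb E y^2<\infty$. Let $H=\mathbb E[xx^\top]$, with an orthonormal eigenbasis $(v_i)$ and eigenvalues $(\lambda_i)$, let $R(w)=\tfrac12\mathbb E(y-\langle w,x\rangle)^2$, let $w^*$ be a minimizer of $R$, and let $\Delta(w)=R(w)-R(w^*)$. For PSD $A$ write $\|u\|_A^2=\langle u,Au\rangle$; for an index set $K$ with complement $K^c$ and $a\ge0$ let $H_{K^c}=\sum_{i\notin K}\lambda_iv_iv_i^\top$ and $aI_K+H_{K^c}=\sum_{i\in K}a\,v_iv_i^\top+\sum_{i\notin K}\lambda_iv_iv_i^\top$. Assume that (A) for some $\alpha>0$, $\mathbb E[xx^\top Axx^\top]\preceq\alpha\,\mathrm{tr}(HA)H$ for every PSD operator $A$; and (N) for some $\sigma^2>0$, $\mathbb E[(y-\langle w^*,x\rangle)^2xx^\top]\preceq\sigma^2H$. Let $N>100$, $N_{\rm eff}=N/\log_2N$, $0<\gamma<1/(4\alpha\,\mathrm{tr}(H))$,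 and $\gamma_t=\gamma/2^{\lfloor t/N_{\rm eff}\rfloor}$ for $0\le t<N$. From a fixed $w_0$ and $N$ independent samples $(x_t,y_t)\sim\mathcal D$, run SGD, $w_t=w_{t-1}-\gamma_{t-1}(x_tx_t^\top w_{t-1}-x_ty_t)$, $t=1,\dots,N$. For an index set $K$ put $D_{\rm eff}(K)=|K|+N_{\rm eff}^2\gamma^2\sum_{i\notin K}\lambda_i^2$, and let $$U(K)=\Big\|\prod_{t=0}^{N-1}(I-\gamma_tH)(w_0-w^*)\Big\|_H^2+\Big(\alpha\|w_0-w^*\|^2_{\frac{I_K}{N_{\rm eff}\gamma}+H_{K^c}}+\sigma^2\Big)\frac{D_{\rm eff}(K)}{N_{\rm eff}} .$$ (1) For every index set $K$ (the bound being $+\infty$ if $K$ is infinite), $\ \mathbb E\,\Delta(w_N)\le C\,U(K)$. (2) Assume in addition that (B) for some $\beta>0$, $\mathbb E[xx^\top Axx^\top]-HAH\succeq\beta\,\mathrm{tr}(HA)H$ for every PSD operator $A$; and (N') $y=\langle w^*,x\rangle+\varepsilon$ with $\varepsilon\sim\mathcal N(0,\sigma^2)$ independent of $x$. Let $K^*=\{k:\lambda_k\ge1/(\gamma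 N_{\rm eff})\}$ and $$L=\Big\|\prod_{t=0}^{N-1}(I-\gamma_tH)(w_0-w^*)\Big\|_H^2+\Big(\beta\|w_0-w^*\|^2_{H_{(K^*)^c}}+\sigma^2\Big)\frac{D_{\rm eff}(K^*)}{N_{\rm eff}} .$$ Then $\mathbb E\,\Delta(w_N)\ge c\,L$. Moreover the two bounds match up to a constant factor when the signal-to-noise ratio is bounded: if $\|w_0-w^*\|_H^2\le R\,\sigma^2$, then $U(K^*)\le(1+\alpha R)\,L$. -/

import Mathlib

open MeasureTheory ProbabilityTheory
open scoped ENNReal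

noncomputable section

namespace TargetSGD

variable {E : Type*} [NormedAddCommGroup E] [InnerProductSpace ℝ E]

/-- The rank-one operator `x xᵀ`, i.e. `u ↦ ⟪x, u⟫ x`. -/
def outer (x : E) : E →L[ℝ] E := InnerProductSpace.rankOne ℝ x x

/-- The squared weighted seminorm `‖u‖²_A = uᵀ A u`. -/
def quad (A : E →L[ℝ] E) (u : E) : ℝ := inner ℝ u (A u)

/-- The trace of an operator, computed in the orthonormal basis `v`. -/
def opTrace {ι : Type*} (v : HilbertBasis ι ℝ E) (T : E →L[ℝ] E) : ℝ :=
  ∑' i, inner ℝ (v i) (T (v i))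

section Distribution

variable [MeasurableSpace E]

/-- The covariance matrix `H = 𝔼[x xᵀ]` of the covariate, for `(x, y) ∼ D`. -/
def cov (D : Measure (E × ℝ)) : E →L[ℝ] E := ∫ p, outer p.1 ∂D

/-- The risk `½ 𝔼 (y - ⟪w, x⟫)²`. -/
def risk (D : Measure (E × ℝ)) (w : E) : ℝ :=
  (1 / 2) * ∫ p, (p.2 - inner ℝ w p.1) ^ 2 ∂D

/-- The excess risk of `w` over the reference parameter `wstar`. -/
def excessRisk (D : Measure (E × ℝ)) (wstar w : E) : ℝ := risk D w - risk D wstar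

/-- The linear regression model: the covariate has a finite fourth moment (hence a covariance
matrix of finite trace), the response has a finite second moment (hence all risks are finite),
and `wstar` minimizes the risk. -/
structure Model (D : Measure (E × ℝ)) (wstar : E) : Prop where
  covariate : MemLp (fun p : E × ℝ => p.1) 4 D
  response : MemLp (fun p : E × ℝ => p.2) 2 D
  minimizer : ∀ w, risk D wstar ≤ risk D w

/-- Fourth moment condition, upper part: `𝔼[x xᵀ A x xᵀ] ⪯ α tr(H A) H` for every PSD `A`. -/
def FourthMomentUpper {ι : Type*} (D : Measure (E × ℝ)) (v : HilbertBasis ι ℝ E) (α : ℝ) : Prop :=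
  ∀ A : E →L[ℝ] E, A.IsPositive →
    ∫ p, outer p.1 ∘L A ∘L outer p.1 ∂D ≤ (α * opTrace v (cov D ∘L A)) • cov D

/-- Fourth moment condition, lower part:
`𝔼[x xᵀ A x xᵀ] - H A H ⪰ β tr(H A) H` for every PSD `A`. -/
def FourthMomentLower {ι : Type*} (D : Measure (E × ℝ)) (v : HilbertBasis ι ℝ E) (β : ℝ) : Prop :=
  ∀ A : E →L[ℝ] E, A.IsPositive →
    (β * opTrace v (cov D ∘L A)) • cov D ≤
      (∫ p, outer p.1 ∘L A ∘L outer p.1 ∂D) - cov D ∘L A ∘L cov D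

/-- Noise condition: `𝔼[(y - ⟪w*, x⟫)² x xᵀ]` exists and is `⪯ σ² H`. -/
def NoiseCondition (D : Measure (E × ℝ)) (wstar : E) (σ : ℝ) : Prop :=
  Integrable (fun p : E × ℝ => (p.2 - inner ℝ wstar p.1) ^ 2 • outer p.1) D ∧
    ∫ p, (p.2 - inner ℝ wstar p.1) ^ 2 • outer p.1 ∂D ≤ σ ^ 2 • cov D

/-- Well-specified noise: `y = ⟪w*, x⟫ + ε` with `ε ∼ N(0, σ²)` independent of `x`. -/
def WellSpecifiedNoise (D : Measure (E × ℝ)) (wstar : E) (σ : ℝ) : Prop :=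
  HasLaw (fun p : E × ℝ => p.2 - inner ℝ wstar p.1) (gaussianReal 0 (Real.toNNReal (σ ^ 2))) D ∧
    IndepFun (fun p : E × ℝ => p.1) (fun p : E × ℝ => p.2 - inner ℝ wstar p.1) D

end Distribution

/-- The effective number of samples `N / log₂ N`. -/
def effN (N : ℕ) : ℝ := N / Real.logb 2 N

/-- The stepsize at time `t < N`: initially `γ`, and halved after every `N / log₂ N` steps. -/
def stepsize (γ : ℝ) (N t : ℕ) : ℝ := γ / 2 ^ ⌊(t : ℝ) / effN N⌋₊

/-- The SGD iterates started at `w₀`, where `z t` is the sample used in step `t + 1`. -/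
def sgd (γ : ℝ) (N : ℕ) (w₀ : E) (z : ℕ → E × ℝ) : ℕ → E
  | 0 => w₀
  | t + 1 =>
      let w := sgd γ N w₀ z t
      w - stepsize γ N t • (inner ℝ (z t).1 w • (z t).1 - (z t).2 • (z t).1)

/-- The expected excess risk of the last SGD iterate, over the draw of the `N` samples `Z`.
The excess risk is nonnegative when `wstar` minimizes the risk, so that its expectation is the
Lebesgue integral. -/
def expectedExcessRisk [MeasurableSpace E] {Ω : Type*} [MeasurableSpace Ω] (P : Measure Ω)
    (D : Measure (E × ℝ)) (wstar : E) (γ : ℝ) (N : ℕ) (w₀ : E) (Z : ℕ → Ω → E × ℝ) : ℝ≥0∞ :=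
  ∫⁻ ω, ENNReal.ofReal (excessRisk D wstar (sgd γ N w₀ (fun t => Z t ω) N)) ∂P

/-- The product `∏_{t < N} (I - γ_t H)`. -/
def contraction (H : E →L[ℝ] E) (γ : ℝ) (N : ℕ) : E →L[ℝ] E :=
  ((List.range N).map (fun t => 1 - stepsize γ N t • H)).prod

/-- `‖u‖²_A` for the operator `A = ∑ i, a i • vᵢ vᵢᵀ` with nonnegative `a`. -/
def specNormSq {ι : Type*} (v : HilbertBasis ι ℝ E) (a : ι → ℝ) (u : E) : ℝ≥0∞ :=
  ∑' i, ENNReal.ofReal (a i * (inner ℝ (v i) u) ^ 2)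

open Classical in
/-- The eigenvalues of `a I_K + H_{Kᶜ}`, where `lam` lists the eigenvalues of `H`. -/
def splitWeights {ι : Type*} (lam : ι → ℝ) (K : Set ι) (a : ℝ) : ι → ℝ :=
  fun i => if i ∈ K then a else lam i

/-- The effective dimension `|K| + N_eff² γ² ∑_{i ∉ K} λᵢ²` (infinite if `K` is infinite). -/
def effDim {ι : Type*} (lam : ι → ℝ) (γ : ℝ) (N : ℕ) (K : Set ι) : ℝ≥0∞ :=
  (K.encard : ℝ≥0∞) +
    ENNReal.ofReal (effN N ^ 2 * γ ^ 2) * ∑' i : (Kᶜ : Set ι), ENNReal.ofReal (lam i ^ 2)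

/-- The index set `{k : λ_k ≥ 1 / (γ N_eff)}`. -/
def optSet {ι : Type*} (lam : ι → ℝ) (γ : ℝ) (N : ℕ) : Set ι :=
  {k | 1 / (γ * effN N) ≤ lam k}

/-- The upper rate
`‖∏(I - γ_t H) u‖²_H + (α ‖u‖²_{I_K / (N_eff γ) + H_{Kᶜ}} + σ²) D_eff / N_eff`. -/
def upperRate {ι : Type*} (H : E →L[ℝ] E) (v : HilbertBasis ι ℝ E) (lam : ι → ℝ) (α σ γ : ℝ)
    (N : ℕ) (u : E) (K : Set ι) : ℝ≥0∞ :=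
  ENNReal.ofReal (quad H (contraction H γ N u)) +
    (ENNReal.ofReal α * specNormSq v (splitWeights lam K (1 / (effN N * γ))) u +
      ENNReal.ofReal (σ ^ 2)) * (effDim lam γ N K / ENNReal.ofReal (effN N))

/-- The lower rate `‖∏(I - γ_t H) u‖²_H + (β ‖u‖²_{H_{Kᶜ}} + σ²) D_eff / N_eff`. -/
def lowerRate {ι : Type*} (H : E →L[ℝ] E) (v : HilbertBasis ι ℝ E) (lam : ι → ℝ) (β σ γ : ℝ)
    (N : ℕ) (u : E) (K : Set ι) : ℝ≥0∞ :=
  ENNReal.ofReal (quad H (contraction H γ N u)) +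
    (ENNReal.ofReal β * specNormSq v (splitWeights lam K 0) u +
      ENNReal.ofReal (σ ^ 2)) * (effDim lam γ N K / ENNReal.ofReal (effN N))

end TargetSGD

end

namespace TargetSGD

/-! Everything is diagonal in the eigenbasis of H. Put n = N_eff, s_t(i) = E⟨v_i, w_t − w*⟩² and e_t
= Σ_j λ_j s_t(j), so that E Δ(w_N) = e_N / 2. Conditionally on the past, first-order optimality of
w* kills the linear noise term, and testing the fourth-moment condition on A = u uᵀ with u = w_t −
w* gives s_{t+1}(i) ≤ (1 − γ_t λ_i)² s_t(i) + 2 γ_t² λ_i (α e_t + σ²). Under (B) and (N') the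
reverse inequality holds with β for α and without the factor 2. The eigendirections interact only
through the scalar e_t, so no operator recursion is needed.

Unrolled and multiplied by λ_i, this is the contracted initial error plus Σ_t q_t² times the
forcing, where q_t = γ_t λ_i ∏_{r>t} (1 − γ_r λ_i). The halving schedule makes Σ_t q_t² comparable
to min(1, n²γ²λ_i²)/n, which is the share of direction i in D_eff(K*)/n (`sum_sq_decay_le`,
`sum_sq_decay_le'`, `le_sum_sq_decay`, `le_sum_sq_decay_of_large`).

It remains to control e_t. From above, its sum over the initial phase of constant stepsize is
bounded by absorbing the feedback through γ α tr H ≤ 1/4 (`sum_risk_first_phase_le`); hence the risk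
is small at some time of that phase, and it stays small afterwards (`risk_le_of_recursion`). From
below, directions outside K* lose only a constant factor over the whole run, so e_t never drops
below a multiple of ‖w₀ − w*‖² in the H_{(K*)ᶜ} seminorm (`ge_of_recursion_optSet`). The two rates
match because 1/(nγ) ≤ λ_i on K*, so the weighted norm in U(K*) is at most ‖w₀ − w*‖_H² ≤ Rσ². -/

lemma one_add_sum_le_prod_one_add {κ : Type*} (S : Finset κ) {f : κ → ℝ} (hf : ∀ i, 0 ≤ f i) :
    1 + ∑ i ∈ S, f i ≤ ∏ i ∈ S, (1 + f i) := by
  classical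
  induction S using Finset.induction_on with
  | empty => simp
  | insert a S ha ih =>
    rw [Finset.sum_insert ha, Finset.prod_insert ha]
    nlinarith [hf a, Finset.sum_nonneg fun i (_ : i ∈ S) => hf i]

/-! ### The stepsize schedule and its tail sums -/

section Stepsize

variable {N : ℕ} {γ : ℝ}

lemma four_le_logb (hN : 100 < N) : 4 ≤ Real.logb 2 N := by
  have h : (100 : ℝ) < N := by exact_mod_cast hN
  rw [Real.le_logb_iff_rpow_le (by norm_num) (by linarith)]
  norm_num
  linarith

lemma logb_le_self (hN : 100 < N) : Real.logb 2 N ≤ N := by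
  have h : (0 : ℝ) < N := by exact_mod_cast (by omega : 0 < N)
  rw [Real.logb_le_iff_le_rpow (by norm_num) h, Real.rpow_natCast]
  exact_mod_cast N.lt_two_pow_self.le

lemma effN_mul_logb (hN : 100 < N) : effN N * Real.logb 2 N = N :=
  div_mul_cancel₀ _ (by linarith [four_le_logb hN])

lemma one_le_effN (hN : 100 < N) : 1 ≤ effN N := by
  rw [effN, one_le_div (by linarith [four_le_logb hN])]
  exact logb_le_self hN

lemma four_mul_effN_le (hN : 100 < N) : 4 * effN N ≤ N := by
  rw [← effN_mul_logb hN]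
  nlinarith [four_le_logb hN, one_le_effN hN]

lemma half_effN_le_floor (hN : 100 < N) : effN N / 2 ≤ (⌊effN N⌋₊ : ℝ) := by
  have h1 := one_le_effN hN
  have h2 : (1 : ℝ) ≤ (⌊effN N⌋₊ : ℝ) := by exact_mod_cast Nat.one_le_floor_iff _ |>.2 h1
  linarith [Nat.lt_floor_add_one (effN N)]

lemma floor_effN_le (hN : 100 < N) : (⌊effN N⌋₊ : ℝ) ≤ effN N :=
  Nat.floor_le (by linarith [one_le_effN hN])

lemma floor_effN_lt (hN : 100 < N) : ⌊effN N⌋₊ < N := by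
  have h1 := one_le_effN hN
  have : (⌊effN N⌋₊ : ℝ) < N := by linarith [floor_effN_le hN, four_mul_effN_le hN]
  exact_mod_cast this

lemma stepsize_pos (hγ : 0 < γ) (t : ℕ) : 0 < stepsize γ N t := by
  unfold stepsize; positivity

lemma stepsize_anti (hN : 100 < N) (hγ : 0 < γ) {r t : ℕ} (h : t ≤ r) :
    stepsize γ N r ≤ stepsize γ N t := by
  have h1 := one_le_effN hN
  unfold stepsize
  gcongr
  norm_num

lemma stepsize_zero : stepsize γ N 0 = γ := by simp [stepsize]

lemma stepsize_le (hN : 100 < N) (hγ : 0 < γ) (t : ℕ) : stepsize γ N t ≤ γ :=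
  (stepsize_anti hN hγ t.zero_le).trans_eq stepsize_zero

lemma stepsize_eq_of_lt (hN : 100 < N) {t : ℕ} (h : t < ⌊effN N⌋₊) : stepsize γ N t = γ := by
  have h1 := one_le_effN hN
  have h2 : (t : ℝ) < effN N := lt_of_lt_of_le (by exact_mod_cast h) (floor_effN_le hN)
  have h3 : ⌊(t : ℝ) / effN N⌋₊ = 0 := by
    rw [Nat.floor_eq_zero, div_lt_one (by linarith)]
    exact h2
  simp [stepsize, h3]

lemma half_stepsize_le (hN : 100 < N) (hγ : 0 < γ) {r t : ℕ} (h : r ≤ t + ⌊effN N⌋₊) :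
    stepsize γ N t / 2 ≤ stepsize γ N r := by
  have h1 := one_le_effN hN
  have h0 : 0 < effN N := by linarith
  have h2 : (r : ℝ) / effN N ≤ (t : ℝ) / effN N + 1 := by
    rw [div_add_one h0.ne']
    have : (r : ℝ) ≤ t + ⌊effN N⌋₊ := by exact_mod_cast h
    gcongr
    linarith [floor_effN_le hN]
  have h3 : ⌊(r : ℝ) / effN N⌋₊ ≤ ⌊(t : ℝ) / effN N⌋₊ + 1 := by
    rw [← Nat.floor_add_one (by positivity)]
    exact Nat.floor_mono h2
  unfold stepsize
  rw [div_div, ← pow_succ]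
  gcongr
  norm_num

lemma stepsize_add_ceil_le (hN : 100 < N) (hγ : 0 < γ) (t : ℕ) :
    stepsize γ N (t + ⌈effN N⌉₊) ≤ stepsize γ N t / 2 := by
  have h1 := one_le_effN hN
  have h0 : 0 < effN N := by linarith
  have h2 : (t : ℝ) / effN N + 1 ≤ ((t + ⌈effN N⌉₊ : ℕ) : ℝ) / effN N := by
    rw [div_add_one h0.ne']
    push_cast
    gcongr
    exact Nat.le_ceil _
  have h3 : ⌊(t : ℝ) / effN N⌋₊ + 1 ≤ ⌊((t + ⌈effN N⌉₊ : ℕ) : ℝ) / effN N⌋₊ := by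
    rw [← Nat.floor_add_one (by positivity)]
    exact Nat.floor_mono h2
  unfold stepsize
  rw [div_div, ← pow_succ]
  gcongr
  norm_num

/-- In the last ⌊n⌋ steps t/n ≥ log₂ N − 1, and taking the floor loses at most one more halving, so
γ has been divided by at least N/4. -/
lemma stepsize_le_of_late (hN : 100 < N) (hγ : 0 < γ) {t : ℕ} (h : N ≤ t + ⌊effN N⌋₊) :
    stepsize γ N t ≤ 4 * γ / N := by
  have h1 := one_le_effN hN
  have h0 : 0 < effN N := by linarith
  have hN0 : (0 : ℝ) < N := by exact_mod_cast (by omega : 0 < N)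
  have h2 : (N : ℝ) ≤ t + ⌊effN N⌋₊ := by exact_mod_cast h
  have h3 : Real.logb 2 N - 1 ≤ (t : ℝ) / effN N := by
    rw [le_div_iff₀ h0]
    linarith [effN_mul_logb hN, floor_effN_le hN]
  have h4 : Real.logb 2 N ≤ (⌊(t : ℝ) / effN N⌋₊ : ℝ) + 2 := by
    linarith [Nat.lt_floor_add_one ((t : ℝ) / effN N)]
  have h5 : (N : ℝ) ≤ 2 ^ ⌊(t : ℝ) / effN N⌋₊ * 4 := by
    rw [Real.logb_le_iff_le_rpow (by norm_num) hN0, Real.rpow_add (by norm_num),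
      Real.rpow_natCast] at h4
    norm_num at h4
    linarith
  unfold stepsize
  rw [div_le_div_iff₀ (by positivity) hN0]
  nlinarith

/-- Each block of ⌈n⌉ steps at least halves the stepsize, so the tail is dominated by a geometric
series of total 2⌈n⌉ γ_t; rounding n up costs the other factor 2. -/
lemma sum_stepsize_tail_le (hN : 100 < N) (hγ : 0 < γ) (t : ℕ) :
    ∑ r ∈ Finset.Ico t N, stepsize γ N r ≤ 4 * effN N * stepsize γ N t := by
  have h1 := one_le_effN hN
  set k := ⌈effN N⌉₊ with hk
  have hk0 : 0 < k := Nat.ceil_pos.2 (by linarith)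
  have hk2 : (k : ℝ) ≤ 2 * effN N := by
    linarith [Nat.ceil_lt_add_one (by linarith : 0 ≤ effN N)]
  have key : ∀ j t : ℕ, N - t ≤ j →
      ∑ r ∈ Finset.Ico t N, stepsize γ N r ≤ 2 * k * stepsize γ N t := by
    intro j
    induction j with
    | zero =>
      intro t ht
      rw [Finset.Ico_eq_empty (by omega), Finset.sum_empty]
      have := stepsize_pos (N := N) hγ t
      positivity
    | succ j ih =>
      intro t ht
      have hsub : Finset.Ico t N ⊆ Finset.Ico t (t + k) ∪ Finset.Ico (t + k) N := by
        intro r; simp only [Finset.mem_Ico, Finset.mem_union]; omega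
      calc ∑ r ∈ Finset.Ico t N, stepsize γ N r
          ≤ ∑ r ∈ Finset.Ico t (t + k) ∪ Finset.Ico (t + k) N, stepsize γ N r :=
            Finset.sum_le_sum_of_subset_of_nonneg hsub fun r _ _ => (stepsize_pos hγ r).le
        _ = ∑ r ∈ Finset.Ico t (t + k), stepsize γ N r
              + ∑ r ∈ Finset.Ico (t + k) N, stepsize γ N r :=
            Finset.sum_union (Finset.Ico_disjoint_Ico_consecutive _ _ _)
        _ ≤ k * stepsize γ N t + 2 * k * stepsize γ N (t + k) := by
            refine add_le_add ?_ (ih _ (by omega))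
            refine (Finset.sum_le_card_nsmul _ _ (stepsize γ N t) fun r hr =>
              stepsize_anti hN hγ (Finset.mem_Ico.1 hr).1).trans_eq ?_
            simp
        _ ≤ k * stepsize γ N t + 2 * k * (stepsize γ N t / 2) := by
            gcongr
            exact stepsize_add_ceil_le hN hγ t
        _ = 2 * k * stepsize γ N t := by ring
  refine (key (N - t) t le_rfl).trans ?_
  have := stepsize_pos (N := N) hγ t
  nlinarith

lemma le_sum_stepsize_tail (hN : 100 < N) (hγ : 0 < γ) {t : ℕ} (ht : t + ⌊effN N⌋₊ < N) :
    effN N * stepsize γ N t / 4 ≤ ∑ r ∈ Finset.Ico (t + 1) N, stepsize γ N r := by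
  have hp := stepsize_pos (N := N) hγ t
  calc effN N * stepsize γ N t / 4 ≤ ⌊effN N⌋₊ * (stepsize γ N t / 2) := by
        nlinarith [half_effN_le_floor hN]
    _ ≤ ∑ r ∈ Finset.Ico (t + 1) (t + 1 + ⌊effN N⌋₊), stepsize γ N r := by
        refine le_trans (by simp) (Finset.card_nsmul_le_sum _ _ (stepsize γ N t / 2) fun r hr =>
          half_stepsize_le hN hγ ?_)
        rw [Finset.mem_Ico] at hr; omega
    _ ≤ _ := by
        refine Finset.sum_le_sum_of_subset_of_nonneg ?_ fun r _ _ => (stepsize_pos hγ r).le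
        exact Finset.Ico_subset_Ico le_rfl (by omega)

/-! ### Contraction along a single eigendirection -/

/-- The factor by which the steps `t, …, N - 1` contract an eigendirection of eigenvalue `l`. -/
noncomputable def decay (γ : ℝ) (N : ℕ) (l : ℝ) (t : ℕ) : ℝ :=
  ∏ r ∈ Finset.Ico t N, (1 - stepsize γ N r * l)

variable {l : ℝ}

lemma stepsize_mul_nonneg (hγ : 0 < γ) (hl : 0 ≤ l) (t : ℕ) : 0 ≤ stepsize γ N t * l :=
  mul_nonneg (stepsize_pos hγ t).le hl

lemma stepsize_mul_le (hN : 100 < N) (hγ : 0 < γ) (hl : 0 ≤ l) (t : ℕ) :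
    stepsize γ N t * l ≤ γ * l :=
  mul_le_mul_of_nonneg_right (stepsize_le hN hγ t) hl

lemma decay_nonneg (hN : 100 < N) (hγ : 0 < γ) (hl : 0 ≤ l) (h1 : γ * l ≤ 1) (t : ℕ) :
    0 ≤ decay γ N l t :=
  Finset.prod_nonneg fun r _ => by linarith [stepsize_mul_le hN hγ hl r]

lemma decay_le_one (hN : 100 < N) (hγ : 0 < γ) (hl : 0 ≤ l) (h1 : γ * l ≤ 1) (t : ℕ) :
    decay γ N l t ≤ 1 :=
  Finset.prod_le_one (fun r _ => by linarith [stepsize_mul_le hN hγ hl r])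
    fun r _ => by linarith [stepsize_mul_nonneg (N := N) hγ hl r]

lemma decay_succ_sub {t : ℕ} (ht : t < N) :
    decay γ N l (t + 1) - decay γ N l t = stepsize γ N t * l * decay γ N l (t + 1) := by
  rw [decay, decay, Finset.prod_eq_prod_Ico_succ_bot ht]
  ring

/-- Each 1 − x pairs with 1 + x to give 1 − x² ≤ 1. The resulting bound 1 / (1 + l Σγ_r) is weaker
than an exponential but is all that the kernel estimate needs. -/
lemma decay_mul_le_one (hN : 100 < N) (hγ : 0 < γ) (hl : 0 ≤ l) (h1 : γ * l ≤ 1) (t : ℕ) :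
    decay γ N l t * (1 + (∑ r ∈ Finset.Ico t N, stepsize γ N r) * l) ≤ 1 := by
  have h2 : 1 + (∑ r ∈ Finset.Ico t N, stepsize γ N r) * l
      ≤ ∏ r ∈ Finset.Ico t N, (1 + stepsize γ N r * l) := by
    rw [Finset.sum_mul]
    exact one_add_sum_le_prod_one_add _ fun r => stepsize_mul_nonneg hγ hl r
  calc _ ≤ decay γ N l t * ∏ r ∈ Finset.Ico t N, (1 + stepsize γ N r * l) :=
        mul_le_mul_of_nonneg_left h2 (decay_nonneg hN hγ hl h1 t)
    _ = ∏ r ∈ Finset.Ico t N, ((1 - stepsize γ N r * l) * (1 + stepsize γ N r * l)) :=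
        Finset.prod_mul_distrib.symm
    _ ≤ 1 := Finset.prod_le_one
        (fun r _ => mul_nonneg (by linarith [stepsize_mul_le hN hγ hl r])
          (by linarith [stepsize_mul_nonneg (N := N) hγ hl r]))
        fun r _ => by nlinarith [stepsize_mul_nonneg (N := N) hγ hl r]

/-- Uses 1 − x ≥ exp(−2x) on [0, 1/2]; the 8 is this 2 times the 4 of `sum_stepsize_tail_le`. -/
lemma exp_le_decay (hN : 100 < N) (hγ : 0 < γ) (hl : 0 ≤ l) (h1 : γ * l ≤ 1 / 2) (t : ℕ) :
    Real.exp (-(8 * (effN N * stepsize γ N t * l))) ≤ decay γ N l t := by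
  calc Real.exp (-(8 * (effN N * stepsize γ N t * l)))
      ≤ Real.exp (∑ r ∈ Finset.Ico t N, -(2 * (stepsize γ N r * l))) := by
        rw [Real.exp_le_exp, Finset.sum_neg_distrib, ← Finset.mul_sum, ← Finset.sum_mul]
        nlinarith [mul_le_mul_of_nonneg_right (sum_stepsize_tail_le hN hγ t) hl]
    _ = ∏ r ∈ Finset.Ico t N, Real.exp (-(2 * (stepsize γ N r * l))) := Real.exp_sum _ _
    _ ≤ _ := by
        refine Finset.prod_le_prod (fun r _ => (Real.exp_pos _).le) fun r _ => ?_
        have h2 := stepsize_mul_nonneg (N := N) hγ hl r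
        have h3 := stepsize_mul_le hN hγ hl r
        set x := stepsize γ N r * l
        rw [Real.exp_neg]
        refine inv_le_of_inv_le₀ (by linarith) ?_
        refine le_trans ?_ (Real.add_one_le_exp (2 * x))
        rw [inv_le_iff_one_le_mul₀ (by linarith)]
        nlinarith

/-- Before the last ⌊n⌋ steps, the remaining stepsizes sum to at least nγ_t/4, so the later
contraction cancels a large γ_t l. In the last ⌊n⌋ steps the stepsize itself is at most 4γ/N. -/
lemma stepsize_mul_decay_le (hN : 100 < N) (hγ : 0 < γ) (hl : 0 ≤ l) (h1 : γ * l ≤ 1) (t : ℕ) :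
    stepsize γ N t * l * decay γ N l (t + 1) ≤ 4 / effN N := by
  have hn := one_le_effN hN
  have hd := decay_nonneg hN hγ hl h1 (t + 1)
  have hd1 := decay_le_one hN hγ hl h1 (t + 1)
  have hx := stepsize_mul_nonneg (N := N) hγ hl t
  rw [le_div_iff₀ (by linarith)]
  by_cases ht : t + ⌊effN N⌋₊ < N
  · have h2 := decay_mul_le_one hN hγ hl h1 (t + 1)
    have h3 := mul_le_mul_of_nonneg_right (le_sum_stepsize_tail hN hγ ht) hl
    nlinarith [mul_le_mul_of_nonneg_left h3 hd]
  · have h2 := stepsize_le_of_late hN hγ (not_lt.1 ht)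
    have hN0 : (0 : ℝ) < N := by exact_mod_cast (by omega : 0 < N)
    have h3 : stepsize γ N t * l ≤ 4 / N := by
      refine (mul_le_mul_of_nonneg_right h2 hl).trans ?_
      rw [div_mul_eq_mul_div]
      gcongr
      linarith
    have h4 : stepsize γ N t * l * effN N ≤ 4 := by
      rw [le_div_iff₀ hN0] at h3
      nlinarith [four_mul_effN_le hN]
    nlinarith [mul_nonneg hx (by linarith : 0 ≤ effN N)]

/-- One factor of each square is bounded by the maximum 4/n; the other is an increment of `decay`
and telescopes. This is the bound for head directions, with no dependence on l. -/
lemma sum_sq_decay_le (hN : 100 < N) (hγ : 0 < γ) (hl : 0 ≤ l) (h1 : γ * l ≤ 1) :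
    ∑ t ∈ Finset.range N, (stepsize γ N t * l * decay γ N l (t + 1)) ^ 2 ≤ 4 / effN N := by
  have hn := one_le_effN hN
  calc _ ≤ ∑ t ∈ Finset.range N, 4 / effN N * (decay γ N l (t + 1) - decay γ N l t) := by
        refine Finset.sum_le_sum fun t ht => ?_
        rw [decay_succ_sub (Finset.mem_range.1 ht), sq]
        exact mul_le_mul_of_nonneg_right (stepsize_mul_decay_le hN hγ hl h1 t)
          (mul_nonneg (stepsize_mul_nonneg hγ hl t) (decay_nonneg hN hγ hl h1 _))
    _ = 4 / effN N * (decay γ N l N - decay γ N l 0) := by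
        rw [← Finset.mul_sum, Finset.sum_range_sub]
    _ ≤ 4 / effN N * 1 := by
        gcongr
        linarith [decay_le_one hN hγ hl h1 N, decay_nonneg hN hγ hl h1 0]
    _ = _ := mul_one _

/-- The bound for tail directions: contraction is ignored and γ_t² ≤ γ γ_t reduces the sum to the
total stepsize, at most 4nγ. -/
lemma sum_sq_decay_le' (hN : 100 < N) (hγ : 0 < γ) (hl : 0 ≤ l) (h1 : γ * l ≤ 1) :
    ∑ t ∈ Finset.range N, (stepsize γ N t * l * decay γ N l (t + 1)) ^ 2
      ≤ 4 * effN N * (γ * l) ^ 2 := by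
  calc _ ≤ ∑ t ∈ Finset.range N, (stepsize γ N t * (γ * l ^ 2)) := by
        refine Finset.sum_le_sum fun t _ => ?_
        have h2 := decay_nonneg hN hγ hl h1 (t + 1)
        have h3 := decay_le_one hN hγ hl h1 (t + 1)
        have h4 := stepsize_pos (N := N) hγ t
        have h5 := stepsize_le hN hγ t
        have h6 : decay γ N l (t + 1) ^ 2 ≤ 1 := pow_le_one₀ h2 h3
        calc _ = (stepsize γ N t * l) ^ 2 * decay γ N l (t + 1) ^ 2 := by ring
          _ ≤ (stepsize γ N t * l) ^ 2 := mul_le_of_le_one_right (by positivity) h6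
          _ = stepsize γ N t * (stepsize γ N t * l ^ 2) := by ring
          _ ≤ _ := by gcongr
    _ = (∑ t ∈ Finset.Ico 0 N, stepsize γ N t) * (γ * l ^ 2) := by
        rw [Finset.sum_mul, Finset.range_eq_Ico]
    _ ≤ 4 * effN N * γ * (γ * l ^ 2) := by
        have := sum_stepsize_tail_le hN hγ 0
        rw [stepsize_zero] at this
        gcongr
    _ = _ := by ring

/-- On the window of ⌊n⌋ ≥ n/2 steps from t, stepsizes stay above γ_t/2 and the later contraction
above e⁻⁸, since nγ_t l ≤ 1. -/
lemma le_sum_sq_decay (hN : 100 < N) (hγ : 0 < γ) (hl : 0 ≤ l) (h1 : γ * l ≤ 1 / 2) {t : ℕ}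
    (ht : t + ⌊effN N⌋₊ ≤ N) (hx : effN N * stepsize γ N t * l ≤ 1) :
    Real.exp (-16) / 8 * effN N * (stepsize γ N t * l) ^ 2 ≤
      ∑ r ∈ Finset.range N, (stepsize γ N r * l * decay γ N l (r + 1)) ^ 2 := by
  have hp := stepsize_pos (N := N) hγ t
  have hdec : Real.exp (-8) ≤ decay γ N l t :=
    (Real.exp_le_exp.2 (by linarith)).trans (exp_le_decay hN hγ hl h1 t)
  have hmono : ∀ r, t ≤ r → r < N → decay γ N l t ≤ decay γ N l (r + 1) := by
    intro r hr hrN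
    rw [decay, ← Finset.prod_Ico_consecutive _ (by omega : t ≤ r + 1) (by omega : r + 1 ≤ N)]
    refine mul_le_of_le_one_left (decay_nonneg hN hγ hl (by linarith) _) ?_
    exact Finset.prod_le_one
      (fun r _ => by linarith [stepsize_mul_le hN hγ hl r])
      fun r _ => by linarith [stepsize_mul_nonneg (N := N) hγ hl r]
  calc Real.exp (-16) / 8 * effN N * (stepsize γ N t * l) ^ 2
      ≤ ⌊effN N⌋₊ * (stepsize γ N t / 2 * l * Real.exp (-8)) ^ 2 := by
        have h2 : Real.exp (-16) = Real.exp (-8) ^ 2 := by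
          rw [← Real.exp_nat_mul]; norm_num
        rw [h2]
        have h3 : 0 ≤ Real.exp (-8) ^ 2 * (stepsize γ N t * l) ^ 2 := by positivity
        nlinarith [mul_le_mul_of_nonneg_right (half_effN_le_floor hN) h3]
    _ ≤ ∑ r ∈ Finset.Ico t (t + ⌊effN N⌋₊),
          (stepsize γ N r * l * decay γ N l (r + 1)) ^ 2 := by
        refine le_trans (by simp) (Finset.card_nsmul_le_sum _ _
          ((stepsize γ N t / 2 * l * Real.exp (-8)) ^ 2) fun r hr => ?_)
        rw [Finset.mem_Ico] at hr
        have h4 := half_stepsize_le hN hγ hr.2.le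
        have h5 := hdec.trans (hmono r hr.1 (by omega))
        have h6 := (Real.exp_pos (-8)).le
        have h7 := stepsize_mul_nonneg (N := N) hγ hl r
        gcongr
    _ ≤ _ := by
        refine Finset.sum_le_sum_of_subset_of_nonneg ?_ fun r _ _ => sq_nonneg _
        intro r hr
        rw [Finset.mem_Ico] at hr
        exact Finset.mem_range.2 (by omega)

/-- A direction with nγl ≥ 1 contributes most when its effective step nγ_t l first falls below 1.
One step earlier it was at least 1, so it is still at least 1/2 there; the late-stage stepsize bound
ensures that a full window of ⌊n⌋ steps remains. -/
lemma le_sum_sq_decay_of_large (hN : 100 < N) (hγ : 0 < γ) (hl : 0 ≤ l) (h1 : γ * l ≤ 1 / 4)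
    (hx : 1 ≤ effN N * γ * l) :
    Real.exp (-16) / 32 / effN N ≤
      ∑ r ∈ Finset.range N, (stepsize γ N r * l * decay γ N l (r + 1)) ^ 2 := by
  have hn := one_le_effN hN
  have hN0 : (0 : ℝ) < N := by exact_mod_cast (by omega : 0 < N)
  have hlate : ∀ t, N ≤ t + ⌊effN N⌋₊ → effN N * stepsize γ N t * l < 1 := by
    intro t ht
    have h2 := stepsize_le_of_late hN hγ ht
    have h3 : stepsize γ N t * l ≤ 1 / N := by
      refine (mul_le_mul_of_nonneg_right h2 hl).trans ?_
      rw [div_mul_eq_mul_div]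
      gcongr
      linarith
    rw [le_div_iff₀ hN0] at h3
    have h4 := four_mul_effN_le hN
    have h5 := stepsize_mul_nonneg (N := N) hγ hl t
    nlinarith
  have hex : ∃ t, effN N * stepsize γ N t * l < 1 := ⟨N, hlate N (by omega)⟩
  classical
  have hs := Nat.find_spec hex
  have hmin : ∀ r < Nat.find hex, ¬ effN N * stepsize γ N r * l < 1 :=
    fun r hr => Nat.find_min hex hr
  generalize Nat.find hex = t at hs hmin
  rcases t with _ | t
  · rw [stepsize_zero] at hs
    linarith
  have h2 := hmin t (by omega)
  have h3 : t + ⌊effN N⌋₊ < N := by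
    by_contra h
    exact h2 (hlate t (not_lt.1 h))
  refine le_trans ?_ (le_sum_sq_decay hN hγ hl (by linarith) (by omega : t + 1 + _ ≤ N) hs.le)
  have hfl : 1 ≤ ⌊effN N⌋₊ := Nat.one_le_floor_iff _ |>.2 hn
  have h4 := half_stepsize_le hN hγ (by omega : t + 1 ≤ t + ⌊effN N⌋₊)
  have h5 : 1 / (2 * effN N) ≤ stepsize γ N (t + 1) * l := by
    rw [div_le_iff₀ (by linarith)]
    have := mul_le_mul_of_nonneg_right (mul_le_mul_of_nonneg_left h4 (by linarith : 0 ≤ effN N)) hl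
    nlinarith
  calc _ = Real.exp (-16) / 8 * effN N * (1 / (2 * effN N)) ^ 2 := by
        field_simp
        norm_num
    _ ≤ _ := by
        gcongr

end Stepsize

/-! ### Scalar linear recursions -/

lemma le_of_recursion {s a f : ℕ → ℝ} {N : ℕ}
    (h : ∀ t < N, s (t + 1) ≤ a t ^ 2 * s t + f t) :
    s N ≤ (∏ r ∈ Finset.Ico 0 N, a r) ^ 2 * s 0 +
      ∑ t ∈ Finset.range N, (∏ r ∈ Finset.Ico (t + 1) N, a r) ^ 2 * f t := by
  induction N with
  | zero => simp
  | succ k ih =>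
    have ih' := ih fun t ht => h t (by omega)
    refine (h k (by omega)).trans ?_
    rw [Finset.sum_range_succ, Finset.Ico_self, Finset.prod_empty,
      Finset.prod_Ico_succ_top (by omega)]
    have : ∑ t ∈ Finset.range k, (∏ r ∈ Finset.Ico (t + 1) (k + 1), a r) ^ 2 * f t
        = a k ^ 2 * ∑ t ∈ Finset.range k, (∏ r ∈ Finset.Ico (t + 1) k, a r) ^ 2 * f t := by
      rw [Finset.mul_sum]
      refine Finset.sum_congr rfl fun t ht => ?_
      rw [Finset.mem_range] at ht
      rw [Finset.prod_Ico_succ_top (by omega)]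
      ring
    rw [this]
    nlinarith [mul_le_mul_of_nonneg_left ih' (sq_nonneg (a k))]

lemma ge_of_recursion {s a f : ℕ → ℝ} {N : ℕ}
    (h : ∀ t < N, a t ^ 2 * s t + f t ≤ s (t + 1)) :
    (∏ r ∈ Finset.Ico 0 N, a r) ^ 2 * s 0 +
      ∑ t ∈ Finset.range N, (∏ r ∈ Finset.Ico (t + 1) N, a r) ^ 2 * f t ≤ s N := by
  have := le_of_recursion (s := fun t => -s t) (a := a) (f := fun t => -f t) (N := N)
    fun t ht => by linarith [h t ht]
  simp only [mul_neg, Finset.sum_neg_distrib] at this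
  linarith

/-- Since (1 − x)² ≤ 1 − x, each x s_t is at most s_t − s_{t+1} + f_t, which telescopes. Used for
head directions, where the number of steps must not enter. -/
lemma sum_mul_le_of_recursion {s f : ℕ → ℝ} {x : ℝ} {m : ℕ} (hx : 0 ≤ x) (hx1 : x ≤ 1)
    (hs : ∀ t, 0 ≤ s t) (h : ∀ t < m, s (t + 1) ≤ (1 - x) ^ 2 * s t + f t) :
    ∑ t ∈ Finset.range m, x * s t ≤ s 0 + ∑ t ∈ Finset.range m, f t := by
  suffices ∑ t ∈ Finset.range m, x * s t + s m ≤ s 0 + ∑ t ∈ Finset.range m, f t by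
    linarith [hs m]
  induction m with
  | zero => simp
  | succ k ih =>
    rw [Finset.sum_range_succ, Finset.sum_range_succ]
    have h1 := ih fun t ht => h t (by omega)
    have h2 := h k (by omega)
    have h3 : (1 - x) ^ 2 * s k ≤ (1 - x) * s k :=
      mul_le_mul_of_nonneg_right (by nlinarith) (hs k)
    linarith

/-- The counterpart for tail directions, where m x may be far below 1 and paying the full s_0 would
be wasteful. The potential is now the positive part of s_m − s_0. -/
lemma sum_mul_le_of_recursion' {s f : ℕ → ℝ} {x : ℝ} {m : ℕ} (hx : 0 ≤ x) (hx1 : x ≤ 1)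
    (hs : ∀ t, 0 ≤ s t) (hf : ∀ t, 0 ≤ f t)
    (h : ∀ t < m, s (t + 1) ≤ (1 - x) ^ 2 * s t + f t) :
    ∑ t ∈ Finset.range m, x * s t ≤ m * x * s 0 + ∑ t ∈ Finset.range m, f t := by
  suffices ∑ t ∈ Finset.range m, x * s t + max (s m - s 0) 0
      ≤ m * x * s 0 + ∑ t ∈ Finset.range m, f t by
    linarith [le_max_right (s m - s 0) 0]
  induction m with
  | zero => simp
  | succ k ih =>
    rw [Finset.sum_range_succ, Finset.sum_range_succ]
    have h1 := ih fun t ht => h t (by omega)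
    have h2 := h k (by omega)
    have h3 : (1 - x) ^ 2 * s k ≤ (1 - x) * s k :=
      mul_le_mul_of_nonneg_right (by nlinarith) (hs k)
    have h4 := le_max_left (s k - s 0) 0
    have h5 := le_max_right (s k - s 0) 0
    -- The excess d = s_k − s_0 satisfies d' ≤ (1 − x)d + f − x s_0; the drop x d pays for the part
    -- of x s_k above x s_0.
    have h6 : max (s (k + 1) - s 0) 0 ≤ max (s k - s 0) 0 - x * (s k - s 0) + f k := by
      refine max_le ?_ ?_
      · nlinarith [mul_nonneg hx (hs 0)]
      · nlinarith [hf k, mul_nonneg (by linarith : 0 ≤ 1 - x) h5]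
    push_cast
    linarith

open Classical in
/-- The contribution of each eigendirection to the effective dimension. -/
noncomputable def dimWeights {ι : Type*} (lam : ι → ℝ) (γ : ℝ) (N : ℕ) (K : Set ι) : ι → ℝ :=
  fun i => if i ∈ K then 1 else effN N ^ 2 * γ ^ 2 * lam i ^ 2

/-! ### The recursion coupled across eigendirections through the risk -/

section Recursion

variable {ι : Type*} {lam : ι → ℝ} {s : ℕ → ι → ℝ} {N : ℕ} {γ α β V : ℝ}

lemma summable_mul_of_le (hl : ∀ i, 0 ≤ lam i) (hsum : Summable lam) {f : ι → ℝ}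
    (hf : ∀ i, 0 ≤ f i) (hfs : Summable f) : Summable fun i => lam i * f i := by
  refine (hfs.mul_left (∑' i, lam i)).of_nonneg_of_le (fun i => mul_nonneg (hl i) (hf i)) fun i => ?_
  exact mul_le_mul_of_nonneg_right (hsum.le_tsum i fun j _ => hl j) (hf i)

/-- Upper bound on the total excess risk collected during the first phase. -/
lemma sum_risk_first_phase_le (hN : 100 < N) (hγ : 0 < γ) (hα : 0 < α) (hV : 0 ≤ V)
    (hl : ∀ i, 0 ≤ lam i) (hsum : Summable lam) (hτ : γ * α * ∑' i, lam i ≤ 1 / 4)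
    (hle : ∀ i, γ * lam i ≤ 1) (hs : ∀ t i, 0 ≤ s t i) (hss : ∀ t ≤ N, Summable (s t))
    (hrec : ∀ t < N, ∀ i, s (t + 1) i ≤ (1 - stepsize γ N t * lam i) ^ 2 * s t i +
      2 * stepsize γ N t ^ 2 * lam i * (α * ∑' j, lam j * s t j + V))
    {K : Set ι} (hK : Summable fun i => splitWeights lam K (1 / (effN N * γ)) i * s 0 i) :
    α * ∑ t ∈ Finset.range ⌊effN N⌋₊, ∑' i, lam i * s t i ≤
      effN N * (2 * α * ∑' i, splitWeights lam K (1 / (effN N * γ)) i * s 0 i + V) := by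
  have hn := one_le_effN hN
  set n := effN N with hn_def
  set m := ⌊n⌋₊ with hm
  set w := splitWeights lam K (1 / (n * γ)) with hw
  set M := ∑' i, w i * s 0 i with hM
  set τ := ∑' i, lam i with hτ_def
  have hmn : (m : ℝ) ≤ n := floor_effN_le hN
  have hmN : m < N := floor_effN_lt hN
  set e : ℕ → ℝ := fun t => ∑' i, lam i * s t i with he
  have he0 : ∀ t, 0 ≤ e t := fun t => tsum_nonneg fun i => mul_nonneg (hl i) (hs t i)
  set F := ∑ r ∈ Finset.range m, (2 * γ ^ 2 * (α * e r + V)) with hF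
  -- Head directions pay s_0 and tail directions nγλ_i s_0; the split weights are chosen so that
  -- both equal nγ w_i s_0.
  have hpt : ∀ i, ∑ t ∈ Finset.range m, γ * (lam i * s t i) ≤ n * γ * (w i * s 0 i) + lam i * F := by
    intro i
    have hx : 0 ≤ γ * lam i := mul_nonneg hγ.le (hl i)
    set f : ℕ → ℝ := fun t => lam i * (2 * γ ^ 2 * (α * e t + V)) with hf
    have hf0 : ∀ t, 0 ≤ f t := fun t => mul_nonneg (hl i)
      (mul_nonneg (by positivity) (add_nonneg (mul_nonneg hα.le (he0 t)) hV))
    have hr : ∀ t < m, s (t + 1) i ≤ (1 - γ * lam i) ^ 2 * s t i + f t := by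
      intro t ht
      have h := hrec t (by omega) i
      rw [stepsize_eq_of_lt hN ht] at h
      refine h.trans_eq ?_
      simp only [hf, he]
      ring
    have hlhs : ∑ t ∈ Finset.range m, γ * (lam i * s t i)
        = ∑ t ∈ Finset.range m, γ * lam i * s t i :=
      Finset.sum_congr rfl fun t _ => by ring
    have hsf : ∑ t ∈ Finset.range m, f t = lam i * F := by rw [hF, Finset.mul_sum]
    rw [hlhs, ← hsf]
    by_cases hi : i ∈ K
    · refine (sum_mul_le_of_recursion hx (hle i) (fun t => hs t i) hr).trans_eq ?_
      have : w i = 1 / (n * γ) := by simp [hw, splitWeights, hi]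
      rw [this]
      field_simp
    · refine (sum_mul_le_of_recursion' hx (hle i) (fun t => hs t i) hf0 hr).trans ?_
      have : w i = lam i := by simp [hw, splitWeights, hi]
      rw [this]
      nlinarith [mul_nonneg hx (hs 0 i)]
  have hse : ∀ t ∈ Finset.range m, Summable fun i => γ * (lam i * s t i) := fun t ht =>
    (summable_mul_of_le hl hsum (hs t) (hss t (by rw [Finset.mem_range] at ht; omega))).mul_left γ
  have htot : γ * ∑ t ∈ Finset.range m, e t ≤ n * γ * M + τ * F := by
    calc γ * ∑ t ∈ Finset.range m, e t = ∑' i, ∑ t ∈ Finset.range m, γ * (lam i * s t i) := by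
          rw [Summable.tsum_finsetSum hse, Finset.mul_sum]
          exact Finset.sum_congr rfl fun t _ => tsum_mul_left.symm
      _ ≤ ∑' i, (n * γ * (w i * s 0 i) + lam i * F) :=
          (summable_sum hse).tsum_le_tsum hpt ((hK.mul_left _).add (hsum.mul_right _))
      _ = _ := by rw [(hK.mul_left _).tsum_add (hsum.mul_right _), tsum_mul_left, tsum_mul_right]
  have hFeq : F = 2 * γ ^ 2 * (α * ∑ t ∈ Finset.range m, e t + m * V) := by
    rw [hF, ← Finset.mul_sum, Finset.sum_add_distrib, ← Finset.mul_sum]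
    simp
  set X := ∑ t ∈ Finset.range m, e t with hX
  have hX0 : 0 ≤ X := Finset.sum_nonneg fun t _ => he0 t
  have hY : 0 ≤ α * X + m * V := by positivity
  -- Feedback is absorbed here: F carries 2γ² and γατ ≤ 1/4, so the accumulated risk returns with
  -- coefficient only 1/2.
  have h1 : α * (τ * F) ≤ γ / 2 * (α * X + m * V) := by
    rw [hFeq]
    nlinarith [mul_le_mul_of_nonneg_right hτ (mul_nonneg hγ.le hY)]
  have h2 : γ * (α * X) ≤ γ * (n * (α * M) + (α * X + m * V) / 2) := by
    nlinarith [mul_le_mul_of_nonneg_left htot hα.le]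
  have h3 := le_of_mul_le_mul_left h2 hγ
  nlinarith [mul_le_mul_of_nonneg_right hmn hV]

/-- If the excess risk is `x` at some time, it stays of order `x + V / α`. -/
lemma risk_le_of_recursion (hN : 100 < N) (hγ : 0 < γ) (hα : 0 < α) (hV : 0 ≤ V)
    (hl : ∀ i, 0 ≤ lam i) (hsum : Summable lam) (hτ : γ * α * ∑' i, lam i ≤ 1 / 4)
    (hle : ∀ i, γ * lam i ≤ 1) (hs : ∀ t i, 0 ≤ s t i) (hss : ∀ t ≤ N, Summable (s t))
    (hrec : ∀ t < N, ∀ i, s (t + 1) i ≤ (1 - stepsize γ N t * lam i) ^ 2 * s t i +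
      2 * stepsize γ N t ^ 2 * lam i * (α * ∑' j, lam j * s t j + V))
    {t₀ t : ℕ} (h0 : t₀ ≤ t) (ht : t ≤ N) :
    α * ∑' i, lam i * s t i ≤ 2 * (α * ∑' i, lam i * s t₀ i) + V := by
  -- B is the fixed point of the bootstrap: the invariant s_t(i) ≤ s_{t₀}(i) + 2γ(B + V) gives α e_t
  -- ≤ α e_{t₀} + (B + V)/2 = B, and this risk bound in turn preserves the invariant, because γ_t ≤
  -- γ.
  set B := 2 * (α * ∑' i, lam i * s t₀ i) + V with hB
  have he0 : 0 ≤ ∑' i, lam i * s t₀ i := tsum_nonneg fun i => mul_nonneg (hl i) (hs t₀ i)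
  have hB0 : 0 ≤ B := by positivity
  have hrisk : ∀ t ≤ N, (∀ i, s t i ≤ s t₀ i + 2 * γ * (B + V)) →
      t₀ ≤ N → α * ∑' i, lam i * s t i ≤ B := by
    intro t ht h ht0
    have hsm := summable_mul_of_le hl hsum (hs t₀) (hss t₀ ht0)
    have : ∑' i, lam i * s t i ≤ ∑' i, lam i * s t₀ i + (∑' i, lam i) * (2 * γ * (B + V)) := by
      rw [← tsum_mul_right, ← hsm.tsum_add (hsum.mul_right _)]
      refine (summable_mul_of_le hl hsum (hs t) (hss t ht)).tsum_le_tsum (fun i => ?_)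
        (hsm.add (hsum.mul_right _))
      rw [← mul_add]
      exact mul_le_mul_of_nonneg_left (h i) (hl i)
    nlinarith [mul_le_mul_of_nonneg_left this hα.le,
      mul_le_mul_of_nonneg_right hτ (by positivity : 0 ≤ B + V)]
  refine hrisk t ht ?_ (h0.trans ht)
  induction t, h0 using Nat.le_induction with
  | base => intro i; nlinarith [mul_nonneg hγ.le (add_nonneg hB0 hV)]
  | succ k hk ih =>
    intro i
    have ih' := ih (by omega)
    have hr := hrisk k (by omega) ih' (by omega)
    have h1 := hrec k (by omega) i
    have hg := stepsize_pos (N := N) hγ k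
    have hgγ := stepsize_le hN hγ k
    have hx := stepsize_mul_nonneg (N := N) hγ (hl i) k
    have hx1 := (stepsize_mul_le hN hγ (hl i) k).trans (hle i)
    set g := stepsize γ N k
    have hD : 0 ≤ B + V := by positivity
    have h2 : (1 - g * lam i) ^ 2 * s k i ≤
        (1 - g * lam i) * (s t₀ i + 2 * γ * (B + V)) := by
      have : (1 - g * lam i) ^ 2 ≤ 1 - g * lam i := by nlinarith
      exact mul_le_mul this (ih' i) (hs k i) (by linarith)
    have h3 : 2 * g ^ 2 * lam i * (α * ∑' j, lam j * s k j + V) ≤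
        2 * g ^ 2 * lam i * (B + V) := by
      have := hl i
      gcongr
    have h4 : 2 * g ^ 2 * lam i * (B + V) ≤ g * lam i * (2 * γ * (B + V)) := by
      nlinarith [mul_le_mul_of_nonneg_right hgγ (mul_nonneg hx hD)]
    nlinarith [mul_nonneg hx (hs t₀ i)]

/-- Early risks are controlled only in sum, so there the kernel enters through its maximum; later
risks are bounded pointwise, so there it enters through its sum of squares. -/
lemma le_of_recursion_of_first_phase (hN : 100 < N) (hγ : 0 < γ) (hα : 0 < α) (hV : 0 ≤ V)
    (hl : ∀ i, 0 ≤ lam i) (hsum : Summable lam) (hτ : γ * α * ∑' i, lam i ≤ 1 / 4)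
    (hle : ∀ i, γ * lam i ≤ 1) (hs : ∀ t i, 0 ≤ s t i) (hss : ∀ t ≤ N, Summable (s t))
    (hrec : ∀ t < N, ∀ i, s (t + 1) i ≤ (1 - stepsize γ N t * lam i) ^ 2 * s t i +
      2 * stepsize γ N t ^ 2 * lam i * (α * ∑' j, lam j * s t j + V))
    (K : Set ι) (hK : Summable fun i => splitWeights lam K (1 / (effN N * γ)) i * s 0 i) (i : ι) :
    lam i * s N i ≤ lam i * (decay γ N (lam i) 0 ^ 2 * s 0 i) +
      128 * (α * ∑' i, splitWeights lam K (1 / (effN N * γ)) i * s 0 i + V) *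
        (dimWeights lam γ N K i / effN N) := by
  have hn := one_le_effN hN
  have hX := sum_risk_first_phase_le hN hγ hα hV hl hsum hτ hle hs hss hrec hK
  set M := ∑' i, splitWeights lam K (1 / (effN N * γ)) i * s 0 i with hM
  have hM0 : 0 ≤ M := tsum_nonneg fun i => by
    refine mul_nonneg ?_ (hs 0 i)
    unfold splitWeights
    split_ifs
    · positivity
    · exact hl i
  have hmn := floor_effN_le hN
  have hmn2 := half_effN_le_floor hN
  have hmN := floor_effN_lt hN
  set e : ℕ → ℝ := fun t => ∑' i, lam i * s t i with he
  have he0 : ∀ t, 0 ≤ e t := fun t => tsum_nonneg fun i => mul_nonneg (hl i) (hs t i)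
  set n := effN N with hn_def
  set m := ⌊n⌋₊ with hm
  -- Some time of the first phase has at most the average risk.
  obtain ⟨t₀, ht₀, hmin⟩ : ∃ t₀ ∈ Finset.range m, e t₀ ≤ (∑ t ∈ Finset.range m, e t) / m := by
    have hm0 : 0 < m := Nat.floor_pos.2 hn
    refine Finset.exists_le_of_sum_le ⟨0, Finset.mem_range.2 hm0⟩ ?_
    rw [Finset.sum_const, Finset.card_range, nsmul_eq_mul, mul_div_cancel₀]
    positivity
  rw [Finset.mem_range] at ht₀
  have hm0 : (0 : ℝ) < m := by linarith
  have hmin' : α * e t₀ ≤ 2 * (2 * α * M + V) := by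
    rw [le_div_iff₀ hm0] at hmin
    have h1 : α * e t₀ * (n / 2) ≤ n * (2 * α * M + V) := by
      nlinarith [mul_le_mul_of_nonneg_left hmn2 (mul_nonneg hα.le (he0 t₀))]
    have h2 : n * (α * e t₀) ≤ n * (2 * (2 * α * M + V)) := by linarith
    exact le_of_mul_le_mul_left h2 (by linarith)
  set h : ℕ → ℝ := fun t => 2 * (α * e t + V) with hh
  have hh0 : ∀ t, 0 ≤ h t := fun t =>
    mul_nonneg zero_le_two (add_nonneg (mul_nonneg hα.le (he0 t)) hV)
  set A := α * M + V with hA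
  have hA0 : 0 ≤ A := by positivity
  have hlate : ∀ t, t₀ ≤ t → t ≤ N → h t ≤ 16 * A := by
    intro t h1 h2
    have h3 : α * e t ≤ 2 * (α * e t₀) + V :=
      risk_le_of_recursion hN hγ hα hV hl hsum hτ hle hs hss hrec h1 h2
    simp only [hh, hA]
    nlinarith
  have hearly : ∑ t ∈ Finset.range m, h t ≤ 4 * n * A := by
    simp only [hh, ← Finset.mul_sum, Finset.sum_add_distrib, Finset.sum_const, Finset.card_range,
      nsmul_eq_mul]
    nlinarith [mul_le_mul_of_nonneg_right hmn hV]
  have hker := le_of_recursion (s := fun t => s t i) (a := fun t => 1 - stepsize γ N t * lam i)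
    (f := fun t => stepsize γ N t ^ 2 * lam i * h t) (N := N) fun t ht =>
      (hrec t ht i).trans_eq (by simp only [hh, he]; ring)
  set q : ℕ → ℝ := fun t => stepsize γ N t * lam i * decay γ N (lam i) (t + 1) with hq
  have hsplit : ∑ t ∈ Finset.range N, q t ^ 2 * h t ≤
      ∑ t ∈ Finset.range m, q t ^ 2 * h t + 16 * A * ∑ t ∈ Finset.range N, q t ^ 2 := by
    have h1 : ∀ t ∈ Finset.range N, q t ^ 2 * h t ≤
        (if t < m then q t ^ 2 * h t else 0) + 16 * A * q t ^ 2 := by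
      intro t ht
      split_ifs with h2
      · have := sq_nonneg (q t); nlinarith
      · have h3 := hlate t (by omega) (Finset.mem_range.1 ht).le
        nlinarith [mul_le_mul_of_nonneg_left h3 (sq_nonneg (q t))]
    refine (Finset.sum_le_sum h1).trans_eq ?_
    rw [Finset.sum_add_distrib, ← Finset.mul_sum, ← Finset.sum_filter]
    congr 2
    ext t
    simp only [Finset.mem_filter, Finset.mem_range]
    omega
  -- In units of A/n, early and late steps each contribute 64 on K: 4²·4 and 16·4. Off K, in units
  -- of A n(γλ_i)², they contribute 4 and 64.
  have hmain : ∑ t ∈ Finset.range N, q t ^ 2 * h t ≤ 128 * A * (dimWeights lam γ N K i / n) := by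
    have hq0 : ∀ t, 0 ≤ q t := fun t => mul_nonneg (stepsize_mul_nonneg hγ (hl i) t)
      (decay_nonneg hN hγ (hl i) (hle i) _)
    refine hsplit.trans ?_
    by_cases hi : i ∈ K
    · have hd : dimWeights lam γ N K i = 1 := by simp [dimWeights, hi]
      rw [hd]
      have h1 : ∑ t ∈ Finset.range m, q t ^ 2 * h t ≤ (4 / n) ^ 2 * (4 * n * A) := by
        refine le_trans ?_ (mul_le_mul_of_nonneg_left hearly (sq_nonneg _))
        rw [Finset.mul_sum]
        refine Finset.sum_le_sum fun t _ => mul_le_mul_of_nonneg_right ?_ (hh0 t)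
        exact pow_le_pow_left₀ (hq0 t) (stepsize_mul_decay_le hN hγ (hl i) (hle i) t) 2
      have h2 := mul_le_mul_of_nonneg_left (sum_sq_decay_le hN hγ (hl i) (hle i))
        (by positivity : 0 ≤ 16 * A)
      refine (add_le_add h1 h2).trans_eq ?_
      rw [← hn_def]
      field_simp
      ring
    · have hd : dimWeights lam γ N K i = n ^ 2 * γ ^ 2 * lam i ^ 2 := by simp [dimWeights, hi, hn_def]
      rw [hd]
      have h1 : ∑ t ∈ Finset.range m, q t ^ 2 * h t ≤ (γ * lam i) ^ 2 * (4 * n * A) := by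
        refine le_trans ?_ (mul_le_mul_of_nonneg_left hearly (sq_nonneg _))
        rw [Finset.mul_sum]
        refine Finset.sum_le_sum fun t _ => mul_le_mul_of_nonneg_right ?_ (hh0 t)
        refine pow_le_pow_left₀ (hq0 t) ?_ 2
        exact (mul_le_of_le_one_right (stepsize_mul_nonneg hγ (hl i) t)
          (decay_le_one hN hγ (hl i) (hle i) _)).trans (stepsize_mul_le hN hγ (hl i) t)
      have h2 := mul_le_mul_of_nonneg_left (sum_sq_decay_le' hN hγ (hl i) (hle i))
        (by positivity : 0 ≤ 16 * A)
      refine (add_le_add h1 h2).trans ?_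
      rw [← hn_def]
      have h3 : 128 * A * (n ^ 2 * γ ^ 2 * lam i ^ 2 / n) = 128 * (A * n * (γ * lam i) ^ 2) := by
        field_simp
      rw [h3]
      have : 0 ≤ A * n * (γ * lam i) ^ 2 := by positivity
      nlinarith
  calc lam i * s N i ≤ lam i * ((∏ r ∈ Finset.Ico 0 N, (1 - stepsize γ N r * lam i)) ^ 2 * s 0 i +
        ∑ t ∈ Finset.range N, (∏ r ∈ Finset.Ico (t + 1) N, (1 - stepsize γ N r * lam i)) ^ 2 *
          (stepsize γ N t ^ 2 * lam i * h t)) := mul_le_mul_of_nonneg_left hker (hl i)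
    _ = lam i * (decay γ N (lam i) 0 ^ 2 * s 0 i) + ∑ t ∈ Finset.range N, q t ^ 2 * h t := by
        rw [mul_add, Finset.mul_sum]
        congr 1
        refine Finset.sum_congr rfl fun t _ => ?_
        simp only [hq, decay]
        ring
    _ ≤ _ := by gcongr

/-- One factor e⁻¹⁶ comes from the persistence of the tail risk, the other, with 1/32, from the
kernel sum; together they give e⁻³²/32. -/
lemma ge_of_recursion_optSet (hN : 100 < N) (hγ : 0 < γ) (hβ : 0 ≤ β) (hV : 0 ≤ V)
    (hl : ∀ i, 0 ≤ lam i) (hsum : Summable lam)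
    (hle : ∀ i, γ * lam i ≤ 1 / 4) (hs : ∀ t i, 0 ≤ s t i) (hss : ∀ t ≤ N, Summable (s t))
    (hrec : ∀ t < N, ∀ i, (1 - stepsize γ N t * lam i) ^ 2 * s t i +
      stepsize γ N t ^ 2 * lam i * (β * ∑' j, lam j * s t j + V) ≤ s (t + 1) i) (i : ι) :
    lam i * (decay γ N (lam i) 0 ^ 2 * s 0 i) +
      Real.exp (-32) / 32 *
        (β * ∑' i, splitWeights lam (optSet lam γ N) 0 i * s 0 i + V) *
        (dimWeights lam γ N (optSet lam γ N) i / effN N) ≤ lam i * s N i := by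
  have hn := one_le_effN hN
  have hn0 : 0 < effN N := by linarith
  set K := optSet lam γ N with hK
  set M := ∑' i, splitWeights lam K 0 i * s 0 i with hM
  have hw0 : ∀ i, 0 ≤ splitWeights lam K 0 i ∧ splitWeights lam K 0 i ≤ lam i := by
    intro i
    unfold splitWeights
    split_ifs
    · exact ⟨le_rfl, hl i⟩
    · exact ⟨hl i, le_rfl⟩
  have hM0 : 0 ≤ M := tsum_nonneg fun i => mul_nonneg (hw0 i).1 (hs 0 i)
  have he0 : ∀ t, 0 ≤ ∑' j, lam j * s t j := fun t =>
    tsum_nonneg fun i => mul_nonneg (hl i) (hs t i)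
  have hsm : Summable fun i => splitWeights lam K 0 i * s 0 i :=
    (summable_mul_of_le hl hsum (hs 0) (hss 0 (by omega))).of_nonneg_of_le
      (fun i => mul_nonneg (hw0 i).1 (hs 0 i))
      fun i => mul_le_mul_of_nonneg_right (hw0 i).2 (hs 0 i)
  have hnotK : ∀ i, i ∉ K → effN N * γ * lam i ≤ 1 := by
    intro i hi
    have h1 : lam i < 1 / (γ * effN N) := not_le.1 hi
    rw [lt_div_iff₀ (by positivity)] at h1
    linarith
  -- Off K, nγλ_j ≤ 1 gives contraction at least e⁻⁸ over the whole run, hence up to any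
  -- intermediate time t; head directions are discarded by their zero weight.
  have hlow : ∀ t ≤ N, Real.exp (-16) * M ≤ ∑' j, lam j * s t j := by
    intro t ht
    rw [hM, ← tsum_mul_left]
    refine (hsm.mul_left _).tsum_le_tsum (fun j => ?_)
      (summable_mul_of_le hl hsum (hs t) (hss t ht))
    by_cases hj : j ∈ K
    · simp only [splitWeights, hj, if_true, zero_mul, mul_zero]
      exact mul_nonneg (hl j) (hs t j)
    · have hker := ge_of_recursion (s := fun t => s t j)
        (a := fun t => 1 - stepsize γ N t * lam j) (f := fun _ => 0) (N := t) fun r hr => by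
          have h1 := hrec r (by omega) j
          have h2 : 0 ≤ stepsize γ N r ^ 2 * lam j * (β * ∑' j, lam j * s r j + V) :=
            mul_nonneg (mul_nonneg (sq_nonneg _) (hl j))
              (add_nonneg (mul_nonneg hβ (he0 r)) hV)
          linarith
      simp only [mul_zero, Finset.sum_const_zero, add_zero] at hker
      have hdec : Real.exp (-8) ≤ decay γ N (lam j) 0 := by
        refine (Real.exp_le_exp.2 ?_).trans (exp_le_decay hN hγ (hl j) (by linarith [hle j]) 0)
        rw [stepsize_zero]
        linarith [hnotK j hj]
      have hpart : decay γ N (lam j) 0 ≤ ∏ r ∈ Finset.Ico 0 t, (1 - stepsize γ N r * lam j) := by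
        rw [decay, ← Finset.prod_Ico_consecutive _ t.zero_le ht]
        refine mul_le_of_le_one_right (Finset.prod_nonneg fun r _ => ?_)
          (decay_le_one hN hγ (hl j) (by linarith [hle j]) t)
        linarith [stepsize_mul_le hN hγ (hl j) r, hle j]
      have h16 : Real.exp (-16) = Real.exp (-8) ^ 2 := by
        rw [← Real.exp_nat_mul]; norm_num
      have h3 : Real.exp (-16) ≤ (∏ r ∈ Finset.Ico 0 t, (1 - stepsize γ N r * lam j)) ^ 2 := by
        rw [h16]
        exact pow_le_pow_left₀ (Real.exp_pos _).le (hdec.trans hpart) 2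
      simp only [splitWeights, hj, if_false]
      nlinarith [mul_le_mul_of_nonneg_left
        ((mul_le_mul_of_nonneg_right h3 (hs 0 j)).trans hker) (hl j)]
  have hker := ge_of_recursion (s := fun t => s t i) (a := fun t => 1 - stepsize γ N t * lam i)
    (f := fun t => stepsize γ N t ^ 2 * lam i * (β * ∑' j, lam j * s t j + V)) (N := N)
    fun t ht => hrec t ht i
  set q : ℕ → ℝ := fun t => stepsize γ N t * lam i * decay γ N (lam i) (t + 1) with hq
  have hvar : Real.exp (-16) / 32 * (dimWeights lam γ N K i / effN N) ≤
      ∑ t ∈ Finset.range N, q t ^ 2 := by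
    by_cases hi : i ∈ K
    · have hd : dimWeights lam γ N K i = 1 := by simp [dimWeights, hi]
      have hi' : 1 / (γ * effN N) ≤ lam i := hi
      rw [div_le_iff₀ (by positivity)] at hi'
      rw [hd]
      refine le_trans (le_of_eq ?_)
        (le_sum_sq_decay_of_large hN hγ (hl i) (hle i) (by linarith))
      ring
    · have hd : dimWeights lam γ N K i = effN N ^ 2 * γ ^ 2 * lam i ^ 2 := by
        simp [dimWeights, hi]
      rw [hd]
      refine le_trans ?_ (le_sum_sq_decay hN hγ (hl i) (by linarith [hle i]) (t := 0)
        (by simpa using (floor_effN_lt hN).le) (by rw [stepsize_zero]; exact hnotK i hi))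
      rw [stepsize_zero]
      have h3 : Real.exp (-16) / 32 * (effN N ^ 2 * γ ^ 2 * lam i ^ 2 / effN N)
          = Real.exp (-16) / 32 * effN N * (γ * lam i) ^ 2 := by
        field_simp
      rw [h3]
      gcongr
      norm_num
  calc _ ≤ lam i * (decay γ N (lam i) 0 ^ 2 * s 0 i) +
        ∑ t ∈ Finset.range N, q t ^ 2 * (Real.exp (-16) * (β * M + V)) := by
        rw [← Finset.sum_mul]
        have h32 : Real.exp (-32) = Real.exp (-16) * Real.exp (-16) := by
          rw [← Real.exp_add]; norm_num
        rw [h32]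
        have := mul_le_mul_of_nonneg_right hvar
          (by positivity : 0 ≤ Real.exp (-16) * (β * M + V))
        linarith
    _ ≤ lam i * (decay γ N (lam i) 0 ^ 2 * s 0 i) +
        ∑ t ∈ Finset.range N, q t ^ 2 * (β * ∑' j, lam j * s t j + V) := by
        gcongr with t ht
        have h1 := mul_le_mul_of_nonneg_left (hlow t (Finset.mem_range.1 ht).le) hβ
        have h2 : Real.exp (-16) ≤ 1 := Real.exp_le_one_iff.2 (by norm_num)
        nlinarith
    _ = lam i * ((∏ r ∈ Finset.Ico 0 N, (1 - stepsize γ N r * lam i)) ^ 2 * s 0 i +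
        ∑ t ∈ Finset.range N, (∏ r ∈ Finset.Ico (t + 1) N, (1 - stepsize γ N r * lam i)) ^ 2 *
          (stepsize γ N t ^ 2 * lam i * (β * ∑' j, lam j * s t j + V))) := by
        rw [mul_add, Finset.mul_sum]
        congr 1
        refine Finset.sum_congr rfl fun t _ => ?_
        simp only [hq, decay]
        ring
    _ ≤ _ := mul_le_mul_of_nonneg_left hker (hl i)

end Recursion

/-! ### Population risk and the conditional expectation of one step -/

section Population

set_option linter.unusedSectionVars false

variable {E : Type*} [NormedAddCommGroup E] [InnerProductSpace ℝ E]

lemma outer_apply (x u : E) : outer x u = inner ℝ x u • x := rfl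

lemma quad_outer_comp (x u v : E) :
    inner ℝ v ((outer x ∘L outer u ∘L outer x) v) = (inner ℝ u x * inner ℝ v x) ^ 2 := by
  simp only [ContinuousLinearMap.comp_apply, outer_apply, inner_smul_right]
  rw [real_inner_comm v x, real_inner_comm u x]
  ring

lemma continuous_outer : Continuous (outer : E → E →L[ℝ] E) :=
  (InnerProductSpace.rankOne ℝ).continuous.clm_apply continuous_id

variable [MeasurableSpace E] {D : Measure (E × ℝ)}

section

variable [CompleteSpace E]

lemma inner_integral_apply {T : E × ℝ → E →L[ℝ] E} (hT : Integrable T D) (a b : E) :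
    inner ℝ a ((∫ p, T p ∂D) b) = ∫ p, inner ℝ a (T p b) ∂D := by
  rw [ContinuousLinearMap.integral_apply hT]
  exact ((innerSL ℝ a).integral_comp_comm (hT.apply_continuousLinearMap b)).symm

end

lemma memLp_inner {q : ℝ≥0∞} (hx : MemLp (fun p : E × ℝ => p.1) q D) (a : E) :
    MemLp (fun p : E × ℝ => inner ℝ a p.1) q D := hx.const_inner a

lemma memLp_inner_mul_inner (hx : MemLp (fun p : E × ℝ => p.1) 4 D) (a b : E) :
    MemLp (fun p : E × ℝ => inner ℝ a p.1 * inner ℝ b p.1) 2 D := by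
  have : ENNReal.HolderTriple 4 4 2 := ⟨by
    rw [← ENNReal.toReal_eq_toReal_iff' (by simp) (by simp)]
    rw [ENNReal.toReal_add (by simp) (by simp)]
    simp
    norm_num⟩
  exact (memLp_inner hx b).mul (memLp_inner hx a)

lemma integrable_norm_pow (hx : MemLp (fun p : E × ℝ => p.1) 4 D) :
    Integrable (fun p : E × ℝ => ‖p.1‖ ^ 4) D := by
  have := hx.integrable_norm_rpow (by norm_num) (by norm_num)
  refine this.congr (Filter.Eventually.of_forall fun p => ?_)
  simp only [ENNReal.toReal_ofNat]
  norm_cast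

variable [IsProbabilityMeasure D]

lemma memLp_inner_two (hx : MemLp (fun p : E × ℝ => p.1) 4 D) (a : E) :
    MemLp (fun p : E × ℝ => inner ℝ a p.1) 2 D :=
  (memLp_inner hx a).mono_exponent (by norm_num)

lemma integrable_norm_sq (hx : MemLp (fun p : E × ℝ => p.1) 4 D) :
    Integrable (fun p : E × ℝ => ‖p.1‖ ^ 2) D := by
  have h2 : MemLp (fun p : E × ℝ => p.1) 2 D := hx.mono_exponent (by norm_num)
  exact (memLp_two_iff_integrable_sq_norm h2.1).1 h2

lemma integrable_outer (hx : MemLp (fun p : E × ℝ => p.1) 4 D) :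
    Integrable (fun p : E × ℝ => outer p.1) D := by
  refine (integrable_norm_sq hx).mono' (continuous_outer.comp_aestronglyMeasurable hx.1)
    (Filter.Eventually.of_forall fun p => ?_)
  simp [outer, sq]

lemma integrable_outer_comp (hx : MemLp (fun p : E × ℝ => p.1) 4 D) (A : E →L[ℝ] E) :
    Integrable (fun p : E × ℝ => outer p.1 ∘L A ∘L outer p.1) D := by
  have hc : Continuous fun x : E => outer x ∘L A ∘L outer x :=
    continuous_outer.clm_comp (continuous_const.clm_comp continuous_outer)
  refine ((integrable_norm_pow hx).mul_const ‖A‖).mono' (hc.comp_aestronglyMeasurable hx.1)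
    (Filter.Eventually.of_forall fun p => ?_)
  have h : ‖outer p.1‖ = ‖p.1‖ ^ 2 := by simp [outer, sq]
  calc ‖outer p.1 ∘L A ∘L outer p.1‖ ≤ ‖outer p.1‖ * (‖A‖ * ‖outer p.1‖) :=
        (ContinuousLinearMap.opNorm_comp_le _ _).trans
          (mul_le_mul_of_nonneg_left (ContinuousLinearMap.opNorm_comp_le _ _) (norm_nonneg _))
    _ = _ := by rw [h]; ring

variable [CompleteSpace E]

lemma inner_cov (hx : MemLp (fun p : E × ℝ => p.1) 4 D) (a b : E) :
    inner ℝ a (cov D b) = ∫ p, inner ℝ a p.1 * inner ℝ b p.1 ∂D := by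
  rw [cov, inner_integral_apply (integrable_outer hx)]
  refine integral_congr_ae (Filter.Eventually.of_forall fun p => ?_)
  simp only [outer_apply, inner_smul_right]
  rw [real_inner_comm b p.1, mul_comm]

lemma inner_cov_comm (hx : MemLp (fun p : E × ℝ => p.1) 4 D) (a b : E) :
    inner ℝ a (cov D b) = inner ℝ (cov D a) b := by
  rw [real_inner_comm b, inner_cov hx, inner_cov hx]
  simp only [mul_comm]

lemma quad_cov (hx : MemLp (fun p : E × ℝ => p.1) 4 D) (a : E) :
    quad (cov D) a = ∫ p, (inner ℝ a p.1) ^ 2 ∂D := by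
  rw [quad, inner_cov hx]
  simp only [sq]

lemma quad_cov_nonneg (hx : MemLp (fun p : E × ℝ => p.1) 4 D) (a : E) :
    0 ≤ quad (cov D) a := by
  rw [quad_cov hx]
  exact integral_nonneg fun p => sq_nonneg _

variable {wstar : E}

lemma memLp_residual (hm : Model D wstar) :
    MemLp (fun p : E × ℝ => p.2 - inner ℝ wstar p.1) 2 D :=
  hm.response.sub (memLp_inner_two hm.covariate wstar)

lemma excessRisk_add (hm : Model D wstar) (a : E) :
    excessRisk D wstar (wstar + a) =
      1 / 2 * quad (cov D) a - ∫ p, (p.2 - inner ℝ wstar p.1) * inner ℝ a p.1 ∂D := by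
  have hξ := memLp_residual hm
  have ha := memLp_inner_two hm.covariate a
  have hc : Integrable (fun p : E × ℝ => (p.2 - inner ℝ wstar p.1) * inner ℝ a p.1) D :=
    hξ.integrable_mul ha
  have hsub : Integrable (fun p : E × ℝ => (p.2 - inner ℝ wstar p.1) ^ 2 -
      2 * ((p.2 - inner ℝ wstar p.1) * inner ℝ a p.1)) D := hξ.integrable_sq.sub (hc.const_mul 2)
  have h : ∀ p : E × ℝ, (p.2 - inner ℝ (wstar + a) p.1) ^ 2 = (p.2 - inner ℝ wstar p.1) ^ 2 -
      2 * ((p.2 - inner ℝ wstar p.1) * inner ℝ a p.1) + (inner ℝ a p.1) ^ 2 := by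
    intro p
    rw [inner_add_left]
    ring
  rw [excessRisk, risk, risk, quad_cov hm.covariate]
  simp_rw [h]
  rw [integral_add hsub ha.integrable_sq,
    integral_sub hξ.integrable_sq (hc.const_mul 2), integral_const_mul]
  ring

/-- First-order optimality of the risk minimizer. -/
lemma integral_residual_mul (hm : Model D wstar) (a : E) :
    ∫ p, (p.2 - inner ℝ wstar p.1) * inner ℝ a p.1 ∂D = 0 := by
  set b := ∫ p, (p.2 - inner ℝ wstar p.1) * inner ℝ a p.1 ∂D with hb
  set q := quad (cov D) a with hq
  have hq0 : 0 ≤ q := quad_cov_nonneg hm.covariate a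
  have key : ∀ r : ℝ, 0 ≤ 1 / 2 * (r ^ 2 * q) - r * b := by
    intro r
    have h1 : 0 ≤ excessRisk D wstar (wstar + r • a) := sub_nonneg.2 (hm.minimizer _)
    rw [excessRisk_add hm] at h1
    have h2 : quad (cov D) (r • a) = r ^ 2 * q := by
      rw [hq, quad, quad, map_smul, inner_smul_left, inner_smul_right]
      simp only [conj_trivial]
      ring
    have h3 : ∫ p, (p.2 - inner ℝ wstar p.1) * inner ℝ (r • a) p.1 ∂D = r * b := by
      rw [hb, ← integral_const_mul]
      refine integral_congr_ae (Filter.Eventually.of_forall fun p => ?_)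
      simp only [inner_smul_left, conj_trivial]
      ring
    rw [h2, h3] at h1
    exact h1
  -- The minimizing multiple would be b/q; q + 1 avoids a separate case q = 0.
  have h := key (b / (q + 1))
  have h4 : 1 / 2 * ((b / (q + 1)) ^ 2 * q) - b / (q + 1) * b
      = -(b ^ 2 * (q / 2 + 1)) / (q + 1) ^ 2 := by
    field_simp
    ring
  rw [h4] at h
  have h5 : 0 ≤ -(b ^ 2 * (q / 2 + 1)) := by
    by_contra hneg
    exact absurd h (not_le.2 (div_neg_of_neg_of_pos (not_le.1 hneg) (by positivity)))
  have h6 : b ^ 2 ≤ 0 := by nlinarith [sq_nonneg b]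
  exact pow_eq_zero_iff two_ne_zero |>.1 (le_antisymm h6 (sq_nonneg b))

lemma excessRisk_eq (hm : Model D wstar) (w : E) :
    excessRisk D wstar w = 1 / 2 * quad (cov D) (w - wstar) := by
  have := excessRisk_add hm (w - wstar)
  rwa [add_sub_cancel, integral_residual_mul hm, sub_zero] at this

variable {σ : ℝ}

/-- The integrability half of the noise condition is essential: an L² residual times an L⁴ covariate
need not be in L². -/
lemma memLp_residual_mul_inner (hm : Model D wstar) (hn : NoiseCondition D wstar σ) (a : E) :
    MemLp (fun p : E × ℝ => (p.2 - inner ℝ wstar p.1) * inner ℝ a p.1) 2 D := by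
  have hmeas : AEStronglyMeasurable
      (fun p : E × ℝ => (p.2 - inner ℝ wstar p.1) * inner ℝ a p.1) D :=
    (memLp_residual hm).1.mul (memLp_inner hm.covariate a).1
  rw [memLp_two_iff_integrable_sq hmeas]
  have h := (innerSL ℝ a).integrable_comp (hn.1.apply_continuousLinearMap a)
  refine h.congr (Filter.Eventually.of_forall fun p => ?_)
  simp only [innerSL_apply_apply, smul_apply, outer_apply, inner_smul_right]
  rw [real_inner_comm a p.1]
  ring

lemma integral_residual_sq_mul_le (hn : NoiseCondition D wstar σ) (a : E) :
    ∫ p, ((p.2 - inner ℝ wstar p.1) * inner ℝ a p.1) ^ 2 ∂D ≤ σ ^ 2 * quad (cov D) a := by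
  have h := (ContinuousLinearMap.le_def _ _).1 hn.2 |>.inner_nonneg_right a
  rw [sub_apply, inner_sub_right, inner_integral_apply hn.1,
    smul_apply, inner_smul_right, sub_nonneg] at h
  refine le_trans (le_of_eq ?_) h
  refine integral_congr_ae (Filter.Eventually.of_forall fun p => ?_)
  simp only [smul_apply, outer_apply, inner_smul_right]
  rw [real_inner_comm a p.1]
  ring

lemma integral_residual_sq_mul_eq (hm : Model D wstar) (hw : WellSpecifiedNoise D wstar σ)
    (a : E) [BorelSpace E] :
    ∫ p, ((p.2 - inner ℝ wstar p.1) * inner ℝ a p.1) ^ 2 ∂D = σ ^ 2 * quad (cov D) a := by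
  have hvar : ∫ p, (p.2 - inner ℝ wstar p.1) ^ 2 ∂D = σ ^ 2 := by
    have h1 : ∫ p, (p.2 - inner ℝ wstar p.1) ^ 2 ∂D
        = ∫ x, x ^ 2 ∂(gaussianReal 0 (Real.toNNReal (σ ^ 2))) := by
      rw [← hw.1.map_eq, integral_map hw.1.aemeasurable (by fun_prop)]
    have h2 := variance_id_gaussianReal (μ := 0) (v := Real.toNNReal (σ ^ 2))
    rw [variance_eq_integral (by fun_prop)] at h2
    simp only [id, integral_id_gaussianReal, sub_zero] at h2
    rw [h1, h2, Real.coe_toNNReal _ (sq_nonneg σ)]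
  have hind : IndepFun (fun p : E × ℝ => (p.2 - inner ℝ wstar p.1) ^ 2)
      (fun p : E × ℝ => (inner ℝ a p.1) ^ 2) D :=
    hw.2.symm.comp (φ := fun r : ℝ => r ^ 2) (ψ := fun x : E => (inner ℝ a x) ^ 2)
      (by fun_prop) (by fun_prop)
  simp_rw [mul_pow]
  rw [hind.integral_fun_mul_eq_mul_integral ((memLp_residual hm).1.pow 2)
    ((memLp_inner hm.covariate a).1.pow 2), hvar, quad_cov hm.covariate]

lemma integral_residual_mul_inner_mul_sq (hm : Model D wstar)
    (hw : WellSpecifiedNoise D wstar σ) (a u : E) [BorelSpace E] :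
    ∫ p, (p.2 - inner ℝ wstar p.1) * (inner ℝ u p.1 * inner ℝ a p.1 ^ 2) ∂D = 0 := by
  have hmean : ∫ p, (p.2 - inner ℝ wstar p.1) ∂D = 0 := by
    have h1 : ∫ p, (p.2 - inner ℝ wstar p.1) ∂D
        = ∫ x, x ∂(gaussianReal 0 (Real.toNNReal (σ ^ 2))) := by
      rw [← hw.1.map_eq, integral_map hw.1.aemeasurable (by fun_prop)]
    rw [h1, integral_id_gaussianReal]
  have hind : IndepFun (fun p : E × ℝ => p.2 - inner ℝ wstar p.1)
      (fun p : E × ℝ => inner ℝ u p.1 * inner ℝ a p.1 ^ 2) D :=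
    hw.2.symm.comp (φ := id) (ψ := fun x : E => inner ℝ u x * inner ℝ a x ^ 2)
      measurable_id (by fun_prop)
  rw [hind.integral_fun_mul_eq_mul_integral (memLp_residual hm).1
    ((memLp_inner hm.covariate u).1.mul ((memLp_inner hm.covariate a).1.pow 2)), hmean, zero_mul]

variable {ι : Type*} {v : HilbertBasis ι ℝ E} {lam : ι → ℝ}

lemma hasSum_quad_cov (hx : MemLp (fun p : E × ℝ => p.1) 4 D)
    (hv : ∀ i, cov D (v i) = lam i • v i) (u : E) :
    HasSum (fun i => lam i * inner ℝ (v i) u ^ 2) (quad (cov D) u) := by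
  refine (v.hasSum_inner_mul_inner u (cov D u)).congr_fun ?_ |> fun h => h
  intro i
  rw [inner_cov_comm hx, hv, inner_smul_left, real_inner_comm u (v i)]
  simp only [conj_trivial]
  ring

lemma opTrace_cov_comp_outer (hx : MemLp (fun p : E × ℝ => p.1) 4 D)
    (hv : ∀ i, cov D (v i) = lam i • v i) (u : E) :
    opTrace v (cov D ∘L outer u) = quad (cov D) u := by
  rw [← (hasSum_quad_cov hx hv u).tsum_eq, opTrace]
  congr 1
  ext i
  rw [ContinuousLinearMap.comp_apply, inner_cov_comm hx, hv, outer_apply, inner_smul_left,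
    inner_smul_right, real_inner_comm u (v i)]
  simp only [conj_trivial]
  ring

lemma quad_cov_basis (hv : ∀ i, cov D (v i) = lam i • v i) (i : ι) :
    quad (cov D) (v i) = lam i := by
  rw [quad, hv, inner_smul_right, real_inner_self_eq_norm_sq, v.orthonormal.1 i]
  norm_num

lemma eigenvalue_nonneg (hx : MemLp (fun p : E × ℝ => p.1) 4 D)
    (hv : ∀ i, cov D (v i) = lam i • v i) (i : ι) : 0 ≤ lam i := by
  rw [← quad_cov_basis hv i]
  exact quad_cov_nonneg hx _

lemma opTrace_cov (hv : ∀ i, cov D (v i) = lam i • v i) : opTrace v (cov D) = ∑' i, lam i :=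
  tsum_congr fun i => quad_cov_basis hv i

/-- Bessel's inequality under the expectation: finite partial sums of eigenvalues are at most E‖x‖².
-/
lemma summable_eigenvalues (hx : MemLp (fun p : E × ℝ => p.1) 4 D)
    (hv : ∀ i, cov D (v i) = lam i • v i) : Summable lam := by
  refine summable_of_sum_le (c := ∫ p, ‖p.1‖ ^ 2 ∂D) (eigenvalue_nonneg hx hv) fun S => ?_
  have h : ∀ i, lam i = ∫ p, (inner ℝ (v i) p.1) ^ 2 ∂D := fun i => by
    rw [← quad_cov hx, quad_cov_basis hv]
  simp_rw [h]
  rw [← integral_finsetSum _ fun i _ => (memLp_inner_two hx (v i)).integrable_sq]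
  refine integral_mono (integrable_finsetSum _ fun i _ => (memLp_inner_two hx (v i)).integrable_sq)
    (integrable_norm_sq hx) fun p => ?_
  have := v.orthonormal.sum_inner_products_le (x := p.1) (s := S)
  simpa [Real.norm_eq_abs, sq_abs] using this

/-- The operator inequality tested on A = u uᵀ, for which tr(HA) is the squared H-norm of u. -/
lemma integral_inner_mul_sq_le (hx : MemLp (fun p : E × ℝ => p.1) 4 D)
    (hv : ∀ i, cov D (v i) = lam i • v i) {α : ℝ} (hα : FourthMomentUpper D v α) (u a : E) :
    ∫ p, (inner ℝ u p.1 * inner ℝ a p.1) ^ 2 ∂D ≤ α * quad (cov D) u * quad (cov D) a := by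
  have h := (ContinuousLinearMap.le_def _ _).1
    (hα (outer u) (InnerProductSpace.isPositive_rankOne_self u)) |>.inner_nonneg_right a
  rw [sub_apply, inner_sub_right,
    inner_integral_apply (integrable_outer_comp hx _), smul_apply,
    inner_smul_right, sub_nonneg, opTrace_cov_comp_outer hx hv] at h
  simp_rw [quad_outer_comp] at h
  exact h

/-- The same test operator; the HAH term supplies the square (λ_i⟨v_i, u⟩)² that the lower recursion
needs. -/
lemma le_integral_inner_mul_sq (hx : MemLp (fun p : E × ℝ => p.1) 4 D)
    (hv : ∀ i, cov D (v i) = lam i • v i) {β : ℝ} (hβ : FourthMomentLower D v β) (u : E) (i : ι) :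
    (lam i * inner ℝ (v i) u) ^ 2 + β * quad (cov D) u * lam i ≤
      ∫ p, (inner ℝ u p.1 * inner ℝ (v i) p.1) ^ 2 ∂D := by
  have h := (ContinuousLinearMap.le_def _ _).1
    (hβ (outer u) (InnerProductSpace.isPositive_rankOne_self u)) |>.inner_nonneg_right (v i)
  rw [sub_apply, inner_sub_right, sub_apply,
    inner_sub_right, inner_integral_apply (integrable_outer_comp hx _),
    smul_apply, inner_smul_right, sub_nonneg,
    opTrace_cov_comp_outer hx hv] at h
  simp_rw [quad_outer_comp] at h
  have h2 : inner ℝ (v i) ((cov D ∘L outer u ∘L cov D) (v i)) = (lam i * inner ℝ (v i) u) ^ 2 := by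
    rw [ContinuousLinearMap.comp_apply, ContinuousLinearMap.comp_apply, inner_cov_comm hx, hv,
      outer_apply, inner_smul_left, inner_smul_right, inner_smul_right, real_inner_comm u (v i)]
    simp only [conj_trivial]
    ring
  have h3 : inner ℝ (v i) (cov D (v i)) = lam i := quad_cov_basis hv i
  rw [h2, h3] at h
  linarith

/-- The constant of the fourth moment condition is at least one. -/
lemma one_le_of_fourthMomentUpper (hx : MemLp (fun p : E × ℝ => p.1) 4 D)
    (hv : ∀ i, cov D (v i) = lam i • v i) {α : ℝ} (hα : FourthMomentUpper D v α) {i : ι}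
    (hi : 0 < lam i) : 1 ≤ α := by
  have h1 := integral_inner_mul_sq_le hx hv hα (v i) (v i)
  rw [quad_cov_basis hv] at h1
  have hint := memLp_inner_mul_inner hx (v i) (v i)
  have h2 : lam i = ∫ p, inner ℝ (v i) p.1 * inner ℝ (v i) p.1 ∂D := by
    rw [← inner_cov hx]; exact (quad_cov_basis hv i).symm
  -- Nonnegative variance of ⟨v_i, x⟩², whose mean is λ_i.
  have h3 : lam i ^ 2 ≤ ∫ p, (inner ℝ (v i) p.1 * inner ℝ (v i) p.1) ^ 2 ∂D := by
    have := variance_nonneg (fun p : E × ℝ => inner ℝ (v i) p.1 * inner ℝ (v i) p.1) D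
    rw [variance_eq_sub hint, ← h2] at this
    simpa using this
  have h4 : lam i ^ 2 * 1 ≤ lam i ^ 2 * α := by nlinarith
  exact le_of_mul_le_mul_left h4 (by positivity)

/-- One step of SGD started at distance `u` from the minimizer, in an eigendirection. -/
lemma integral_step_sq (hm : Model D wstar) (hn : NoiseCondition D wstar σ)
    (hv : ∀ i, cov D (v i) = lam i • v i) (g : ℝ) (u : E) (i : ι) :
    Integrable (fun p : E × ℝ => (inner ℝ (v i) u +
      g * ((p.2 - inner ℝ wstar p.1 - inner ℝ u p.1) * inner ℝ (v i) p.1)) ^ 2) D ∧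
    ∫ p, (inner ℝ (v i) u +
      g * ((p.2 - inner ℝ wstar p.1 - inner ℝ u p.1) * inner ℝ (v i) p.1)) ^ 2 ∂D =
      (1 - 2 * (g * lam i)) * inner ℝ (v i) u ^ 2 +
        g ^ 2 * ∫ p, ((p.2 - inner ℝ wstar p.1) * inner ℝ (v i) p.1 -
          inner ℝ u p.1 * inner ℝ (v i) p.1) ^ 2 ∂D := by
  have h1 := memLp_residual_mul_inner hm hn (v i)
  have h2 := memLp_inner_mul_inner hm.covariate u (v i)
  have h12 := h1.sub h2
  set c := inner ℝ (v i) u with hc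
  have hexp : ∀ p : E × ℝ, (c +
      g * ((p.2 - inner ℝ wstar p.1 - inner ℝ u p.1) * inner ℝ (v i) p.1)) ^ 2 =
      (c ^ 2 + 2 * c * g * ((p.2 - inner ℝ wstar p.1) * inner ℝ (v i) p.1 -
          inner ℝ u p.1 * inner ℝ (v i) p.1)) +
        g ^ 2 * ((p.2 - inner ℝ wstar p.1) * inner ℝ (v i) p.1 -
          inner ℝ u p.1 * inner ℝ (v i) p.1) ^ 2 := fun p => by ring
  simp_rw [hexp]
  have hi12 : Integrable (fun p : E × ℝ => (p.2 - inner ℝ wstar p.1) * inner ℝ (v i) p.1 -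
          inner ℝ u p.1 * inner ℝ (v i) p.1) D := h12.integrable (by norm_num)
  have hA : Integrable (fun p : E × ℝ => c ^ 2 + 2 * c * g *
      ((p.2 - inner ℝ wstar p.1) * inner ℝ (v i) p.1 - inner ℝ u p.1 * inner ℝ (v i) p.1)) D :=
    (integrable_const (c ^ 2)).add (hi12.const_mul (2 * c * g))
  have hB : Integrable (fun p : E × ℝ => g ^ 2 * ((p.2 - inner ℝ wstar p.1) * inner ℝ (v i) p.1 -
          inner ℝ u p.1 * inner ℝ (v i) p.1) ^ 2) D := h12.integrable_sq.const_mul _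
  refine ⟨hA.add hB, ?_⟩
  have hlin : ∫ p : E × ℝ, ((p.2 - inner ℝ wstar p.1) * inner ℝ (v i) p.1 -
          inner ℝ u p.1 * inner ℝ (v i) p.1) ∂D = -(lam i * c) := by
    rw [integral_sub (h1.integrable (by norm_num)) (h2.integrable (by norm_num)),
      integral_residual_mul hm, ← inner_cov hm.covariate, hv, inner_smul_right, hc,
      real_inner_comm u (v i)]
    ring
  rw [integral_add hA hB, integral_add (integrable_const _) (hi12.const_mul _),
    integral_const_mul, integral_const_mul, hlin]
  simp
  ring

lemma integral_step_sq_le (hm : Model D wstar) (hn : NoiseCondition D wstar σ)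
    (hv : ∀ i, cov D (v i) = lam i • v i) {α : ℝ} (hα : FourthMomentUpper D v α)
    (g : ℝ) (u : E) (i : ι) :
    ∫ p, (inner ℝ (v i) u +
      g * ((p.2 - inner ℝ wstar p.1 - inner ℝ u p.1) * inner ℝ (v i) p.1)) ^ 2 ∂D ≤
      (1 - g * lam i) ^ 2 * inner ℝ (v i) u ^ 2 +
        2 * g ^ 2 * lam i * (α * quad (cov D) u + σ ^ 2) := by
  rw [(integral_step_sq hm hn hv g u i).2]
  have h1 := memLp_residual_mul_inner hm hn (v i)
  have h2 := memLp_inner_mul_inner hm.covariate u (v i)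
  have hle : ∫ p, ((p.2 - inner ℝ wstar p.1) * inner ℝ (v i) p.1 -
          inner ℝ u p.1 * inner ℝ (v i) p.1) ^ 2 ∂D ≤
      2 * (σ ^ 2 * lam i) + 2 * (α * quad (cov D) u * lam i) := by
    calc _ ≤ ∫ p, (2 * ((p.2 - inner ℝ wstar p.1) * inner ℝ (v i) p.1) ^ 2 +
          2 * (inner ℝ u p.1 * inner ℝ (v i) p.1) ^ 2) ∂D := by
          refine integral_mono (h1.sub h2).integrable_sq
            ((h1.integrable_sq.const_mul 2).add (h2.integrable_sq.const_mul 2)) fun p => ?_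
          nlinarith [sq_nonneg ((p.2 - inner ℝ wstar p.1) * inner ℝ (v i) p.1 +
            inner ℝ u p.1 * inner ℝ (v i) p.1)]
      _ ≤ _ := by
          rw [integral_add (h1.integrable_sq.const_mul 2) (h2.integrable_sq.const_mul 2),
            integral_const_mul, integral_const_mul]
          have h3 := integral_residual_sq_mul_le hn (v i)
          have h4 := integral_inner_mul_sq_le hm.covariate hv hα u (v i)
          rw [quad_cov_basis hv] at h3 h4
          linarith
  -- Here 1 − 2gλ_i ≤ (1 − gλ_i)². The 2 in the forcing comes from (a − b)² ≤ 2a² + 2b², as noise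
  -- and covariate may be dependent.
  nlinarith [mul_le_mul_of_nonneg_left hle (sq_nonneg g), sq_nonneg (g * lam i * inner ℝ (v i) u)]

lemma le_integral_step_sq [BorelSpace E] (hm : Model D wstar) (hn : NoiseCondition D wstar σ)
    (hw : WellSpecifiedNoise D wstar σ)
    (hv : ∀ i, cov D (v i) = lam i • v i) {β : ℝ} (hβ : FourthMomentLower D v β)
    (g : ℝ) (u : E) (i : ι) :
    (1 - g * lam i) ^ 2 * inner ℝ (v i) u ^ 2 +
        g ^ 2 * lam i * (β * quad (cov D) u + σ ^ 2) ≤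
    ∫ p, (inner ℝ (v i) u +
      g * ((p.2 - inner ℝ wstar p.1 - inner ℝ u p.1) * inner ℝ (v i) p.1)) ^ 2 ∂D := by
  rw [(integral_step_sq hm hn hv g u i).2]
  have h1 := memLp_residual_mul_inner hm hn (v i)
  have h2 := memLp_inner_mul_inner hm.covariate u (v i)
  have hle : σ ^ 2 * lam i + ((lam i * inner ℝ (v i) u) ^ 2 + β * quad (cov D) u * lam i) ≤
      ∫ p, ((p.2 - inner ℝ wstar p.1) * inner ℝ (v i) p.1 -
          inner ℝ u p.1 * inner ℝ (v i) p.1) ^ 2 ∂D := by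
    have hc : Integrable (fun p : E × ℝ =>
        (p.2 - inner ℝ wstar p.1) * (inner ℝ u p.1 * inner ℝ (v i) p.1 ^ 2)) D := by
      refine (h1.integrable_mul h2).congr (Filter.Eventually.of_forall fun p => ?_)
      simp only [Pi.mul_apply]
      ring
    have hexp : ∀ p : E × ℝ, ((p.2 - inner ℝ wstar p.1) * inner ℝ (v i) p.1 -
          inner ℝ u p.1 * inner ℝ (v i) p.1) ^ 2 =
        ((p.2 - inner ℝ wstar p.1) * inner ℝ (v i) p.1) ^ 2 -
          2 * ((p.2 - inner ℝ wstar p.1) * (inner ℝ u p.1 * inner ℝ (v i) p.1 ^ 2)) +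
          (inner ℝ u p.1 * inner ℝ (v i) p.1) ^ 2 := fun p => by ring
    simp_rw [hexp]
    have hsub : Integrable (fun p : E × ℝ =>
        ((p.2 - inner ℝ wstar p.1) * inner ℝ (v i) p.1) ^ 2 -
          2 * ((p.2 - inner ℝ wstar p.1) * (inner ℝ u p.1 * inner ℝ (v i) p.1 ^ 2))) D :=
      h1.integrable_sq.sub (hc.const_mul 2)
    rw [integral_add hsub h2.integrable_sq,
      integral_sub h1.integrable_sq (hc.const_mul 2), integral_const_mul,
      integral_residual_mul_inner_mul_sq hm hw, integral_residual_sq_mul_eq hm hw,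
      quad_cov_basis hv]
    linarith [le_integral_inner_mul_sq hm.covariate hv hβ u i]
  -- The HAH contribution completes 1 − 2gλ_i to (1 − gλ_i)² exactly; the cross term has vanished by
  -- independence.
  nlinarith [mul_le_mul_of_nonneg_left hle (sq_nonneg g)]

lemma inner_contraction (hx : MemLp (fun p : E × ℝ => p.1) 4 D)
    (hv : ∀ i, cov D (v i) = lam i • v i) (γ : ℝ) (N : ℕ) (u : E) (i : ι) :
    inner ℝ (v i) (contraction (cov D) γ N u) = decay γ N (lam i) 0 * inner ℝ (v i) u := by
  have key : ∀ l : List ℕ,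
      inner ℝ (v i) ((l.map fun t => 1 - stepsize γ N t • cov D).prod u) =
        (l.map fun t => 1 - stepsize γ N t * lam i).prod * inner ℝ (v i) u := by
    intro l
    induction l with
    | nil => simp
    | cons t l ih =>
      rw [List.map_cons, List.prod_cons, List.map_cons, List.prod_cons, mul_assoc, ← ih]
      rw [mul_apply_eq_comp, sub_apply, inner_sub_right,
        smul_apply, inner_smul_right, inner_cov_comm hx, hv, inner_smul_left]
      simp only [one_apply_eq_self, conj_trivial]
      ring
  rw [contraction, key, decay, ← Finset.range_eq_Ico]
  rfl

end Population

/-! ### Second moments of the SGD iterates -/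

section Dynamics

variable {E : Type*} [NormedAddCommGroup E] [InnerProductSpace ℝ E]

/-- Basis vectors are √2 apart, so balls of radius 1/2 are disjoint. Countability permits exchanging
the eigenbasis sum with the integral. -/
lemma countable_of_hilbertBasis [SecondCountableTopology E] {ι : Type*} (v : HilbertBasis ι ℝ E) :
    Countable ι := by
  rw [← Set.countable_univ_iff]
  refine Set.PairwiseDisjoint.countable_of_isOpen (s := fun i => Metric.ball (v i) (1 / 2)) ?_
    (fun i _ => Metric.isOpen_ball) fun i _ => ⟨v i, Metric.mem_ball_self (by norm_num)⟩
  intro i _ j _ hij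
  refine Metric.ball_disjoint_ball ?_
  rw [dist_eq_norm]
  have h : ‖v i - v j‖ ^ 2 = 2 := by
    rw [norm_sub_sq_real, v.orthonormal.1 i, v.orthonormal.1 j, v.orthonormal.2 hij]
    norm_num
  nlinarith [norm_nonneg (v i - v j)]

lemma sgd_congr {γ : ℝ} {N : ℕ} {w₀ : E} {z z' : ℕ → E × ℝ} {t : ℕ} (h : ∀ r < t, z r = z' r) :
    sgd γ N w₀ z t = sgd γ N w₀ z' t := by
  induction t with
  | zero => rfl
  | succ t ih => simp only [sgd, ih fun r hr => h r (by omega), h t (by omega)]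

lemma inner_sgd_succ_sub {γ : ℝ} {N : ℕ} (w wstar a : E) (t : ℕ) (p : E × ℝ) :
    inner ℝ a (w - stepsize γ N t • (inner ℝ p.1 w • p.1 - p.2 • p.1) - wstar) =
      inner ℝ a (w - wstar) + stepsize γ N t *
        ((p.2 - inner ℝ wstar p.1 - inner ℝ (w - wstar) p.1) * inner ℝ a p.1) := by
  simp only [inner_sub_right, inner_sub_left, inner_smul_right]
  rw [real_inner_comm p.1 w]
  ring

variable [SecondCountableTopology E] [MeasurableSpace E] [BorelSpace E]

lemma measurable_sgd (γ : ℝ) (N : ℕ) (w₀ : E) (t : ℕ) :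
    Measurable fun z : ℕ → E × ℝ => sgd γ N w₀ z t := by
  induction t with
  | zero => exact measurable_const
  | succ t ih => simp only [sgd]; fun_prop

variable {Ω : Type*} [MeasurableSpace Ω] {P : Measure Ω} [IsProbabilityMeasure P]
  {D : Measure (E × ℝ)} {Z : ℕ → Ω → E × ℝ} {N : ℕ}

/-- The current iterate and the next sample are independent. -/
lemma map_sgd_prodMk (hZ : ∀ t < N, HasLaw (Z t) D P)
    (hind : iIndepFun (fun t : Fin N => Z t) P) (γ : ℝ) (w₀ : E) {t : ℕ} (ht : t ≤ N) :
    AEMeasurable (fun ω => sgd γ N w₀ (fun r => Z r ω) t) P ∧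
      (t < N → P.map (fun ω => (sgd γ N w₀ (fun r => Z r ω) t, Z t ω)) =
        (P.map fun ω => sgd γ N w₀ (fun r => Z r ω) t).prod D) := by
  set S : Finset (Fin N) := Finset.univ.filter fun r => r.1 < t with hS
  -- Unseen samples are filled with 0, which is harmless because the iterate at time t reads only
  -- samples r < t.
  set ext : (S → E × ℝ) → ℕ → E × ℝ := fun y r =>
    if h : r < t then y ⟨⟨r, h.trans_le ht⟩, by simp [hS, h]⟩ else 0 with hext
  have hext_meas : Measurable ext := by
    refine measurable_pi_lambda _ fun r => ?_
    by_cases h : r < t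
    · simp only [hext, h, dif_pos]
      exact measurable_pi_apply _
    · simp only [hext, h, dif_neg, not_false_eq_true]
      exact measurable_const
  have hsgd : (fun ω => sgd γ N w₀ (fun r => Z r ω) t) =
      (fun y => sgd γ N w₀ (ext y) t) ∘ fun ω (r : S) => Z r.1 ω := by
    funext ω
    refine sgd_congr fun r hr => ?_
    simp [hext, hr]
  have hφ : Measurable fun y => sgd γ N w₀ (ext y) t := (measurable_sgd γ N w₀ t).comp hext_meas
  have hae : ∀ r : Fin N, AEMeasurable (Z r) P := fun r => (hZ r r.2).aemeasurable
  have hpast : AEMeasurable (fun ω (r : S) => Z r.1 ω) P :=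
    aemeasurable_pi_lambda _ fun r => hae r.1
  refine ⟨hsgd ▸ hφ.comp_aemeasurable hpast, fun htN => ?_⟩
  have hdisj : Disjoint S {(⟨t, htN⟩ : Fin N)} := by simp [hS]
  have hi := (hind.indepFun_finset₀ S {⟨t, htN⟩} hdisj hae).comp hφ
    (measurable_pi_apply (⟨⟨t, htN⟩, Finset.mem_singleton_self _⟩ : ({⟨t, htN⟩} : Finset (Fin N))))
  rw [← hsgd] at hi
  have hi' : IndepFun (fun ω => sgd γ N w₀ (fun r => Z r ω) t) (Z t) P := hi
  rw [(indepFun_iff_map_prod_eq_prod_map_map (hsgd ▸ hφ.comp_aemeasurable hpast)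
    (hZ t htN).aemeasurable).1 hi', (hZ t htN).map_eq]

/-- The second moment of the error of a random vector in a basis direction. -/
noncomputable def secondMoment {ι : Type*} (P : Measure Ω) (v : HilbertBasis ι ℝ E) (wstar : E)
    (W : Ω → E) (i : ι) : ℝ≥0∞ :=
  ∫⁻ ω, ENNReal.ofReal (inner ℝ (v i) (W ω - wstar) ^ 2) ∂P

variable {ι : Type*} {v : HilbertBasis ι ℝ E} {lam : ι → ℝ} [CompleteSpace E]
  [IsProbabilityMeasure D] {wstar : E} {σ : ℝ}

lemma lintegral_quad_cov (hx : MemLp (fun p : E × ℝ => p.1) 4 D)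
    (hv : ∀ i, cov D (v i) = lam i • v i) {W : Ω → E} (hW : AEMeasurable W P) :
    ∫⁻ ω, ENNReal.ofReal (quad (cov D) (W ω - wstar)) ∂P =
      ∑' i, ENNReal.ofReal (lam i) * secondMoment P v wstar W i := by
  have := countable_of_hilbertBasis v
  have hl := eigenvalue_nonneg hx hv
  have h : ∀ ω, ENNReal.ofReal (quad (cov D) (W ω - wstar)) =
      ∑' i, ENNReal.ofReal (lam i) * ENNReal.ofReal (inner ℝ (v i) (W ω - wstar) ^ 2) := by
    intro ω
    have hs := hasSum_quad_cov hx hv (W ω - wstar)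
    rw [← hs.tsum_eq, ENNReal.ofReal_tsum_of_nonneg
      (fun i => mul_nonneg (hl i) (sq_nonneg _)) hs.summable]
    simp_rw [ENNReal.ofReal_mul (hl _)]
  simp_rw [h, secondMoment]
  rw [lintegral_tsum fun i => by fun_prop]
  refine tsum_congr fun i => lintegral_const_mul'' _ (by fun_prop)

lemma expectedExcessRisk_eq (hm : Model D wstar) (hv : ∀ i, cov D (v i) = lam i • v i)
    (hZ : ∀ t < N, HasLaw (Z t) D P) (hind : iIndepFun (fun t : Fin N => Z t) P)
    (γ : ℝ) (w₀ : E) :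
    expectedExcessRisk P D wstar γ N w₀ Z = ENNReal.ofReal (1 / 2) *
      ∑' i, ENNReal.ofReal (lam i) *
        secondMoment P v wstar (fun ω => sgd γ N w₀ (fun r => Z r ω) N) i := by
  have hW := (map_sgd_prodMk hZ hind γ w₀ le_rfl).1
  rw [expectedExcessRisk, ← lintegral_quad_cov hm.covariate hv hW]
  simp_rw [excessRisk_eq hm, ENNReal.ofReal_mul (by norm_num : (0 : ℝ) ≤ 1 / 2)]
  refine lintegral_const_mul'' _ ?_
  have hq : Continuous fun u : E => quad (cov D) u := by unfold quad; fun_prop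
  exact (hq.measurable.comp_aemeasurable (hW.sub_const _)).ennreal_ofReal

/-- Conditioning on the past by Tonelli: the joint law of iterate and fresh sample is a product, so
the iterate is frozen in the inner integral. -/
lemma secondMoment_sgd_succ (hm : Model D wstar) (hn : NoiseCondition D wstar σ)
    (hv : ∀ i, cov D (v i) = lam i • v i)
    (hZ : ∀ t < N, HasLaw (Z t) D P) (hind : iIndepFun (fun t : Fin N => Z t) P)
    (γ : ℝ) (w₀ : E) {t : ℕ} (ht : t < N) (i : ι) :
    secondMoment P v wstar (fun ω => sgd γ N w₀ (fun r => Z r ω) (t + 1)) i =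
      ∫⁻ ω, ENNReal.ofReal (∫ p, (inner ℝ (v i) (sgd γ N w₀ (fun r => Z r ω) t - wstar) +
        stepsize γ N t * ((p.2 - inner ℝ wstar p.1 -
          inner ℝ (sgd γ N w₀ (fun r => Z r ω) t - wstar) p.1) * inner ℝ (v i) p.1)) ^ 2 ∂D) ∂P := by
  obtain ⟨hW, hmap⟩ := map_sgd_prodMk hZ hind γ w₀ ht.le
  set W : Ω → E := fun ω => sgd γ N w₀ (fun r => Z r ω) t with hW_def
  set f : E × (E × ℝ) → ℝ≥0∞ := fun q => ENNReal.ofReal ((inner ℝ (v i) (q.1 - wstar) +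
        stepsize γ N t * ((q.2.2 - inner ℝ wstar q.2.1 -
          inner ℝ (q.1 - wstar) q.2.1) * inner ℝ (v i) q.2.1)) ^ 2) with hf
  have hfm : Measurable f := by fun_prop
  have h1 : secondMoment P v wstar (fun ω => sgd γ N w₀ (fun r => Z r ω) (t + 1)) i =
      ∫⁻ ω, f (W ω, Z t ω) ∂P := by
    refine lintegral_congr fun ω => ?_
    simp only [hf, sgd, inner_sgd_succ_sub, hW_def]
  rw [h1, ← lintegral_map' hfm.aemeasurable (hW.prodMk (hZ t ht).aemeasurable), hmap ht,
    lintegral_prod _ hfm.aemeasurable, lintegral_map' hfm.lintegral_prod_right'.aemeasurable hW]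
  refine lintegral_congr fun ω => ?_
  rw [ofReal_integral_eq_lintegral_ofReal (integral_step_sq hm hn hv _ _ i).1
    (Filter.Eventually.of_forall fun p => sq_nonneg _)]

lemma lintegral_ofReal_recursion (hx : MemLp (fun p : E × ℝ => p.1) 4 D)
    (hv : ∀ i, cov D (v i) = lam i • v i) {W : Ω → E} (hW : AEMeasurable W P)
    {c d α : ℝ} (hc : 0 ≤ c) (hd : 0 ≤ d) (hα : 0 ≤ α) (i : ι) :
    ∫⁻ ω, ENNReal.ofReal (c * inner ℝ (v i) (W ω - wstar) ^ 2 +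
        d * (α * quad (cov D) (W ω - wstar) + σ ^ 2)) ∂P =
      ENNReal.ofReal c * secondMoment P v wstar W i + ENNReal.ofReal d *
        (ENNReal.ofReal α * ∑' j, ENNReal.ofReal (lam j) * secondMoment P v wstar W j +
          ENNReal.ofReal (σ ^ 2)) := by
  have hq0 : ∀ u, 0 ≤ quad (cov D) u := quad_cov_nonneg hx
  have hq : Continuous fun u : E => quad (cov D) u := by unfold quad; fun_prop
  have hqm : AEMeasurable (fun ω => ENNReal.ofReal (quad (cov D) (W ω - wstar))) P :=
    (hq.measurable.comp_aemeasurable (hW.sub_const _)).ennreal_ofReal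
  have h : ∀ ω, ENNReal.ofReal (c * inner ℝ (v i) (W ω - wstar) ^ 2 +
        d * (α * quad (cov D) (W ω - wstar) + σ ^ 2)) =
      ENNReal.ofReal c * ENNReal.ofReal (inner ℝ (v i) (W ω - wstar) ^ 2) +
        ENNReal.ofReal d * (ENNReal.ofReal α * ENNReal.ofReal (quad (cov D) (W ω - wstar)) +
          ENNReal.ofReal (σ ^ 2)) := by
    intro ω
    have := hq0 (W ω - wstar)
    rw [ENNReal.ofReal_add (by positivity) (by positivity), ENNReal.ofReal_mul hc,
      ENNReal.ofReal_mul hd, ENNReal.ofReal_add (by positivity) (by positivity),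
      ENNReal.ofReal_mul hα]
  simp_rw [h]
  rw [lintegral_add_left' (by fun_prop), lintegral_const_mul'' _ (by fun_prop),
    lintegral_const_mul'' _ (by fun_prop), lintegral_add_left' (by fun_prop),
    lintegral_const_mul'' _ hqm, lintegral_quad_cov hx hv hW]
  simp [secondMoment]

lemma secondMoment_sgd_succ_le (hm : Model D wstar) (hn : NoiseCondition D wstar σ)
    (hv : ∀ i, cov D (v i) = lam i • v i) {α : ℝ} (hα0 : 0 ≤ α) (hα : FourthMomentUpper D v α)
    (hZ : ∀ t < N, HasLaw (Z t) D P) (hind : iIndepFun (fun t : Fin N => Z t) P)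
    (γ : ℝ) (w₀ : E) {t : ℕ} (ht : t < N) (i : ι) :
    secondMoment P v wstar (fun ω => sgd γ N w₀ (fun r => Z r ω) (t + 1)) i ≤
      ENNReal.ofReal ((1 - stepsize γ N t * lam i) ^ 2) *
        secondMoment P v wstar (fun ω => sgd γ N w₀ (fun r => Z r ω) t) i +
      ENNReal.ofReal (2 * stepsize γ N t ^ 2 * lam i) *
        (ENNReal.ofReal α * ∑' j, ENNReal.ofReal (lam j) *
          secondMoment P v wstar (fun ω => sgd γ N w₀ (fun r => Z r ω) t) j +
          ENNReal.ofReal (σ ^ 2)) := by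
  have hl := eigenvalue_nonneg hm.covariate hv i
  rw [secondMoment_sgd_succ hm hn hv hZ hind γ w₀ ht, ← lintegral_ofReal_recursion hm.covariate hv
    (map_sgd_prodMk hZ hind γ w₀ ht.le).1 (sq_nonneg _) (by positivity) hα0]
  exact lintegral_mono fun ω => ENNReal.ofReal_le_ofReal (integral_step_sq_le hm hn hv hα _ _ i)

lemma le_secondMoment_sgd_succ (hm : Model D wstar) (hn : NoiseCondition D wstar σ)
    (hw : WellSpecifiedNoise D wstar σ)
    (hv : ∀ i, cov D (v i) = lam i • v i) {β : ℝ} (hβ0 : 0 ≤ β) (hβ : FourthMomentLower D v β)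
    (hZ : ∀ t < N, HasLaw (Z t) D P) (hind : iIndepFun (fun t : Fin N => Z t) P)
    (γ : ℝ) (w₀ : E) {t : ℕ} (ht : t < N) (i : ι) :
    ENNReal.ofReal ((1 - stepsize γ N t * lam i) ^ 2) *
        secondMoment P v wstar (fun ω => sgd γ N w₀ (fun r => Z r ω) t) i +
      ENNReal.ofReal (stepsize γ N t ^ 2 * lam i) *
        (ENNReal.ofReal β * ∑' j, ENNReal.ofReal (lam j) *
          secondMoment P v wstar (fun ω => sgd γ N w₀ (fun r => Z r ω) t) j +
          ENNReal.ofReal (σ ^ 2)) ≤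
    secondMoment P v wstar (fun ω => sgd γ N w₀ (fun r => Z r ω) (t + 1)) i := by
  have hl := eigenvalue_nonneg hm.covariate hv i
  rw [secondMoment_sgd_succ hm hn hv hZ hind γ w₀ ht, ← lintegral_ofReal_recursion hm.covariate hv
    (map_sgd_prodMk hZ hind γ w₀ ht.le).1 (sq_nonneg _) (by positivity) hβ0]
  exact lintegral_mono fun ω =>
    ENNReal.ofReal_le_ofReal (le_integral_step_sq hm hn hw hv hβ _ _ i)

lemma secondMoment_sgd_zero (w₀ : E) (γ : ℝ) (i : ι) :
    secondMoment P v wstar (fun ω => sgd γ N w₀ (fun r => Z r ω) 0) i =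
      ENNReal.ofReal (inner ℝ (v i) (w₀ - wstar) ^ 2) := by
  simp [secondMoment, sgd]

end Dynamics

/-! ### The rates as sums over eigendirections -/

section Rates

variable {ι : Type*} {lam : ι → ℝ} {N : ℕ} {γ : ℝ}

lemma dimWeights_nonneg (K : Set ι) (i : ι) : 0 ≤ dimWeights lam γ N K i := by
  unfold dimWeights
  split_ifs <;> positivity

lemma tsum_dimWeights (K : Set ι) :
    ∑' i, ENNReal.ofReal (dimWeights lam γ N K i) = effDim lam γ N K := by
  have h := Summable.tsum_add_tsum_compl (f := fun i => ENNReal.ofReal (dimWeights lam γ N K i))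
    (s := K) ENNReal.summable ENNReal.summable
  rw [← h, effDim, ← ENNReal.tsum_set_one, ← ENNReal.tsum_mul_left]
  congr 1
  · refine tsum_congr fun i => ?_
    simp [dimWeights]
  · refine tsum_congr fun i => ?_
    have hi : (i : ι) ∉ K := i.2
    rw [← ENNReal.ofReal_mul (by positivity)]
    simp [dimWeights, hi]

lemma tsum_dimWeights_div (hN : 100 < N) (K : Set ι) :
    ∑' i, ENNReal.ofReal (dimWeights lam γ N K i / effN N) =
      effDim lam γ N K / ENNReal.ofReal (effN N) := by
  have hn := one_le_effN hN
  simp_rw [ENNReal.ofReal_div_of_pos (by linarith : 0 < effN N), div_eq_mul_inv]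
  rw [ENNReal.tsum_mul_right, tsum_dimWeights]

variable {E : Type*} [NormedAddCommGroup E] [InnerProductSpace ℝ E] {v : HilbertBasis ι ℝ E}

lemma summable_inner_sq (u : E) : Summable fun i => inner ℝ (v i) u ^ 2 := by
  refine (v.summable_inner_mul_inner u u).congr fun i => ?_
  rw [real_inner_comm u (v i), sq]

lemma specNormSq_eq {a : ι → ℝ} {u : E} (ha : ∀ i, 0 ≤ a i)
    (hs : Summable fun i => a i * inner ℝ (v i) u ^ 2) :
    specNormSq v a u = ENNReal.ofReal (∑' i, a i * inner ℝ (v i) u ^ 2) :=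
  (ENNReal.ofReal_tsum_of_nonneg (fun i => mul_nonneg (ha i) (sq_nonneg _)) hs).symm

lemma splitWeights_nonneg (hl : ∀ i, 0 ≤ lam i) (K : Set ι) {a : ℝ} (ha : 0 ≤ a) (i : ι) :
    0 ≤ splitWeights lam K a i := by
  unfold splitWeights
  split_ifs
  exacts [ha, hl i]

lemma summable_splitWeights (hl : ∀ i, 0 ≤ lam i) (hsum : Summable lam) (K : Set ι) {a : ℝ}
    (ha : 0 ≤ a) {f : ι → ℝ} (hf : ∀ i, 0 ≤ f i) (hfs : Summable f) :
    Summable fun i => splitWeights lam K a i * f i := by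
  refine ((hfs.mul_left a).add (summable_mul_of_le hl hsum hf hfs)).of_nonneg_of_le
    (fun i => mul_nonneg (splitWeights_nonneg hl K ha i) (hf i)) fun i => ?_
  unfold splitWeights
  split_ifs
  · linarith [mul_nonneg (hl i) (hf i)]
  · linarith [mul_nonneg ha (hf i)]

variable [CompleteSpace E] [MeasurableSpace E] {D : Measure (E × ℝ)} [IsProbabilityMeasure D]

lemma ofReal_quad_contraction (hx : MemLp (fun p : E × ℝ => p.1) 4 D)
    (hv : ∀ i, cov D (v i) = lam i • v i) (u : E) :
    ENNReal.ofReal (quad (cov D) (contraction (cov D) γ N u)) =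
      ∑' i, ENNReal.ofReal (lam i * (decay γ N (lam i) 0 ^ 2 * inner ℝ (v i) u ^ 2)) := by
  have h := hasSum_quad_cov hx hv (contraction (cov D) γ N u)
  simp_rw [inner_contraction hx hv, mul_pow] at h
  have hl := eigenvalue_nonneg hx hv
  rw [← h.tsum_eq, ENNReal.ofReal_tsum_of_nonneg (fun i => mul_nonneg (hl i) (by positivity))
    h.summable]

end Rates

/-! ### Finiteness of second moments and passage to real numbers -/

section FiniteMoments

variable {ι : Type*} {lam : ι → ℝ} {N : ℕ} {γ α V : ℝ} {S : ℕ → ι → ℝ≥0∞}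

/-- The total second moment stays finite because the forcing is summable over directions (finite
trace) and e_t is at most tr H times that total. This licenses replacing extended by real moments.
-/
lemma tsum_ne_top_of_recursion (hN : 100 < N) (hγ : 0 < γ) (hl : ∀ i, 0 ≤ lam i)
    (hsum : Summable lam) (hle : ∀ i, γ * lam i ≤ 1) (h0 : ∑' i, S 0 i ≠ ∞)
    (hrec : ∀ t < N, ∀ i, S (t + 1) i ≤ ENNReal.ofReal ((1 - stepsize γ N t * lam i) ^ 2) * S t i +
      ENNReal.ofReal (2 * stepsize γ N t ^ 2 * lam i) *
        (ENNReal.ofReal α * ∑' j, ENNReal.ofReal (lam j) * S t j + ENNReal.ofReal V))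
    {t : ℕ} (ht : t ≤ N) : ∑' i, S t i ≠ ∞ := by
  induction t with
  | zero => exact h0
  | succ t ih =>
    have ih' := ih (by omega)
    have hX : ∑' j, ENNReal.ofReal (lam j) * S t j ≠ ∞ := by
      refine ne_top_of_le_ne_top (ENNReal.mul_ne_top ENNReal.ofReal_ne_top ih') ?_
        (b := ENNReal.ofReal (∑' i, lam i) * ∑' i, S t i)
      rw [← ENNReal.tsum_mul_left]
      exact ENNReal.tsum_le_tsum fun i => mul_le_mul_left
        (ENNReal.ofReal_le_ofReal (hsum.le_tsum i fun j _ => hl j)) _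
    have hlt : ∑' i, ENNReal.ofReal (2 * stepsize γ N t ^ 2 * lam i) ≠ ∞ := by
      rw [← ENNReal.ofReal_tsum_of_nonneg (fun i => mul_nonneg (by positivity) (hl i))
        (hsum.mul_left _)]
      exact ENNReal.ofReal_ne_top
    refine ne_top_of_le_ne_top ?_ (ENNReal.tsum_le_tsum (hrec t (by omega)))
    rw [ENNReal.tsum_add, ENNReal.tsum_mul_right]
    refine ENNReal.add_ne_top.2 ⟨ne_top_of_le_ne_top ih' (ENNReal.tsum_le_tsum fun i => ?_),
      ENNReal.mul_ne_top hlt (by finiteness)⟩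
    refine mul_le_of_le_one_left zero_le (ENNReal.ofReal_le_one.2 ?_)
    have h1 := stepsize_mul_nonneg (N := N) hγ (hl i) t
    have h2 := (stepsize_mul_le hN hγ (hl i) t).trans (hle i)
    nlinarith

lemma tsum_ofReal_mul_eq (hl : ∀ i, 0 ≤ lam i) (hsum : Summable lam) {s : ι → ℝ≥0∞}
    (hs : ∑' i, s i ≠ ∞) :
    ∑' i, ENNReal.ofReal (lam i) * s i = ENNReal.ofReal (∑' i, lam i * (s i).toReal) := by
  rw [ENNReal.ofReal_tsum_of_nonneg (fun i => mul_nonneg (hl i) ENNReal.toReal_nonneg)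
    (summable_mul_of_le hl hsum (fun i => ENNReal.toReal_nonneg) (ENNReal.summable_toReal hs))]
  refine tsum_congr fun i => ?_
  rw [ENNReal.ofReal_mul (hl i), ENNReal.ofReal_toReal (ENNReal.ne_top_of_tsum_ne_top hs i)]

lemma ofReal_recursion_eq (hl : ∀ i, 0 ≤ lam i) (hsum : Summable lam) {s : ι → ℝ≥0∞}
    (hs : ∑' i, s i ≠ ∞) {c d a : ℝ} (hc : 0 ≤ c) (hd : 0 ≤ d) (ha : 0 ≤ a) (hV : 0 ≤ V) (i : ι) :
    ENNReal.ofReal c * s i + ENNReal.ofReal d *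
        (ENNReal.ofReal a * ∑' j, ENNReal.ofReal (lam j) * s j + ENNReal.ofReal V) =
      ENNReal.ofReal (c * (s i).toReal + d * (a * ∑' j, lam j * (s j).toReal + V)) := by
  have h1 : 0 ≤ ∑' j, lam j * (s j).toReal :=
    tsum_nonneg fun j => mul_nonneg (hl j) ENNReal.toReal_nonneg
  have h2 : 0 ≤ (s i).toReal := ENNReal.toReal_nonneg
  rw [tsum_ofReal_mul_eq hl hsum hs, ENNReal.ofReal_add (by positivity) (by positivity),
    ENNReal.ofReal_mul hc, ENNReal.ofReal_mul hd, ENNReal.ofReal_add (by positivity) hV,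
    ENNReal.ofReal_mul ha, ENNReal.ofReal_toReal (ENNReal.ne_top_of_tsum_ne_top hs i)]

end FiniteMoments

/-! ### Comparison of the two rates -/

/-- For a bounded signal-to-noise ratio, the upper rate is at most a multiple of the lower rate. -/
theorem upperRate_optSet_le {ι E : Type*} [NormedAddCommGroup E] [InnerProductSpace ℝ E]
    [CompleteSpace E] [MeasurableSpace E] {D : Measure (E × ℝ)} [IsProbabilityMeasure D]
    {v : HilbertBasis ι ℝ E} {lam : ι → ℝ} (hx : MemLp (fun p : E × ℝ => p.1) 4 D)
    (hv : ∀ i, cov D (v i) = lam i • v i) {N : ℕ} {α β σ γ R : ℝ}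
    (hα : 0 < α) (hσ : 0 < σ) {u : E} (hR : quad (cov D) u ≤ R * σ ^ 2) :
    upperRate (cov D) v lam α σ γ N u (optSet lam γ N) ≤
      ENNReal.ofReal (1 + α * R) * lowerRate (cov D) v lam β σ γ N u (optSet lam γ N) := by
  have hR0 : 0 ≤ R := by
    by_contra h
    nlinarith [quad_cov_nonneg hx u, mul_pos (neg_pos.2 (not_le.1 h)) (pow_pos hσ 2)]
  have hl := eigenvalue_nonneg hx hv
  -- By definition of `optSet`, the head weight 1/(nγ) is at most λ_i, so the split norm is
  -- dominated by the H-norm.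
  have hspec : specNormSq v (splitWeights lam (optSet lam γ N) (1 / (effN N * γ))) u ≤
      ENNReal.ofReal (R * σ ^ 2) := by
    refine le_trans ?_ (ENNReal.ofReal_le_ofReal hR)
    have h := hasSum_quad_cov hx hv u
    rw [← h.tsum_eq, ENNReal.ofReal_tsum_of_nonneg
      (fun i => mul_nonneg (hl i) (sq_nonneg _)) h.summable]
    refine ENNReal.tsum_le_tsum fun i => ENNReal.ofReal_le_ofReal
      (mul_le_mul_of_nonneg_right ?_ (sq_nonneg _))
    unfold splitWeights
    split_ifs with hi
    · rw [mul_comm]; exact hi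
    · exact le_rfl
  have h1 : 1 ≤ ENNReal.ofReal (1 + α * R) := by
    rw [ENNReal.one_le_ofReal]
    nlinarith
  have h2 : ENNReal.ofReal α * ENNReal.ofReal (R * σ ^ 2) + ENNReal.ofReal (σ ^ 2) =
      ENNReal.ofReal (1 + α * R) * ENNReal.ofReal (σ ^ 2) := by
    rw [← ENNReal.ofReal_mul hα.le, ← ENNReal.ofReal_add (by positivity) (by positivity),
      ← ENNReal.ofReal_mul (by positivity)]
    congr 1
    ring
  unfold upperRate lowerRate
  rw [mul_add, ← mul_assoc]
  refine add_le_add (le_mul_of_one_le_left zero_le h1) (mul_le_mul_left ?_ _)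
  calc _ ≤ ENNReal.ofReal α * ENNReal.ofReal (R * σ ^ 2) + ENNReal.ofReal (σ ^ 2) := by gcongr
    _ = ENNReal.ofReal (1 + α * R) * ENNReal.ofReal (σ ^ 2) := h2
    -- The β term of the lower rate is not needed: σ² alone dominates.
    _ ≤ _ := by gcongr; exact le_add_self

end TargetSGD

/-! ### The main theorem -/

open TargetSGD in
theorem corollary4 :
    ∃ C c : ℝ, 0 < C ∧ 0 < c ∧
      ∀ (E : Type*) [NormedAddCommGroup E] [InnerProductSpace ℝ E] [CompleteSpace E]
        [SecondCountableTopology E] [MeasurableSpace E] [BorelSpace E]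
        (ι : Type*) (v : HilbertBasis ι ℝ E) (lam : ι → ℝ)
        (D : Measure (E × ℝ)) [IsProbabilityMeasure D] (wstar : E)
        (Ω : Type*) [MeasurableSpace Ω] (P : Measure Ω) [IsProbabilityMeasure P]
        (N : ℕ) (Z : ℕ → Ω → E × ℝ) (w₀ : E) (α σ γ : ℝ),
        TargetSGD.Model D wstar →
        (∀ i, TargetSGD.cov D (v i) = lam i • v i) →
        0 < α → TargetSGD.FourthMomentUpper D v α →
        0 < σ → TargetSGD.NoiseCondition D wstar σ →
        100 < N →
        (∀ t < N, HasLaw (Z t) D P) → iIndepFun (fun t : Fin N => Z t) P →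
        0 < γ → γ < 1 / (4 * α * TargetSGD.opTrace v (TargetSGD.cov D)) →
        (∀ K : Set ι,
          TargetSGD.expectedExcessRisk P D wstar γ N w₀ Z ≤
            ENNReal.ofReal C *
              TargetSGD.upperRate (TargetSGD.cov D) v lam α σ γ N (w₀ - wstar) K) ∧
        (∀ β : ℝ, 0 < β → TargetSGD.FourthMomentLower D v β →
          TargetSGD.WellSpecifiedNoise D wstar σ →
          ENNReal.ofReal c *
              TargetSGD.lowerRate (TargetSGD.cov D) v lam β σ γ N (w₀ - wstar)
                (TargetSGD.optSet lam γ N) ≤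
            TargetSGD.expectedExcessRisk P D wstar γ N w₀ Z ∧
          ∀ R : ℝ, TargetSGD.quad (TargetSGD.cov D) (w₀ - wstar) ≤ R * σ ^ 2 →
            TargetSGD.upperRate (TargetSGD.cov D) v lam α σ γ N (w₀ - wstar)
                (TargetSGD.optSet lam γ N) ≤
              ENNReal.ofReal (1 + α * R) *
                TargetSGD.lowerRate (TargetSGD.cov D) v lam β σ γ N (w₀ - wstar)
                  (TargetSGD.optSet lam γ N)) := by
  -- The 1/2 of the risk is kept in the lower constant and discarded in the upper one.
  refine ⟨128, 1 / 2 * (Real.exp (-32) / 32), by norm_num, by positivity, ?_⟩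
  intro E _ _ _ _ _ _ ι v lam D _ wstar Ω _ P _ N Z w₀ α σ γ hm hv hα hA hσ hn hN hZ hind hγ hγ1
  have hx := hm.covariate
  have hl := eigenvalue_nonneg hx hv
  have hsum := summable_eigenvalues hx hv
  rw [opTrace_cov hv] at hγ1
  -- A zero trace is excluded by the stepsize bound, since then 1/0 = 0 would force γ < 0.
  have hτ0 : 0 < ∑' i, lam i := by
    refine (tsum_nonneg hl).lt_of_ne fun h => ?_
    rw [← h, mul_zero, div_zero] at hγ1
    linarith
  have hτ : γ * α * ∑' i, lam i ≤ 1 / 4 := by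
    rw [lt_div_iff₀ (by positivity)] at hγ1
    linarith
  -- With α ≥ 1, the bound on γ α tr H also bounds every γλ_i by 1/4.
  have hα1 : 1 ≤ α := by
    obtain ⟨i, hi⟩ : ∃ i, lam i ≠ 0 := by
      by_contra! h
      simp [h] at hτ0
    exact one_le_of_fourthMomentUpper hx hv hA ((hl i).lt_of_ne' hi)
  have hle : ∀ i, γ * lam i ≤ 1 / 4 := by
    intro i
    have h1 : lam i ≤ ∑' i, lam i := hsum.le_tsum i fun j _ => hl j
    have h2 : γ * lam i ≤ γ * ∑' i, lam i := mul_le_mul_of_nonneg_left h1 hγ.le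
    nlinarith [mul_pos hγ hτ0]
  have hle1 : ∀ i, γ * lam i ≤ 1 := fun i => (hle i).trans (by norm_num)
  set u := w₀ - wstar with hu
  set S : ℕ → ι → ℝ≥0∞ := fun t i =>
    secondMoment P v wstar (fun ω => sgd γ N w₀ (fun r => Z r ω) t) i with hS
  have hup := fun t (ht : t < N) i => secondMoment_sgd_succ_le hm hn hv hα.le hA hZ hind γ w₀ ht i
  have hS0 : ∀ i, S 0 i = ENNReal.ofReal (inner ℝ (v i) u ^ 2) := secondMoment_sgd_zero w₀ γ
  have hs0 : ∀ i, (S 0 i).toReal = inner ℝ (v i) u ^ 2 := fun i => by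
    rw [hS0, ENNReal.toReal_ofReal (sq_nonneg _)]
  have hS0_top : ∑' i, S 0 i ≠ ∞ := by
    simp_rw [hS0]
    rw [← ENNReal.ofReal_tsum_of_nonneg (fun i => sq_nonneg _) (summable_inner_sq u)]
    exact ENNReal.ofReal_ne_top
  have hfin : ∀ t ≤ N, ∑' i, S t i ≠ ∞ := fun t ht =>
    tsum_ne_top_of_recursion hN hγ hl hsum hle1 hS0_top hup ht
  set s : ℕ → ι → ℝ := fun t i => (S t i).toReal with hs_def
  have hs : ∀ t i, 0 ≤ s t i := fun t i => ENNReal.toReal_nonneg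
  have hss : ∀ t ≤ N, Summable (s t) := fun t ht => ENNReal.summable_toReal (hfin t ht)
  have hSs : ∀ t ≤ N, ∀ i, S t i = ENNReal.ofReal (s t i) := fun t ht i =>
    (ENNReal.ofReal_toReal (ENNReal.ne_top_of_tsum_ne_top (hfin t ht) i)).symm
  have he0 : ∀ t, 0 ≤ ∑' j, lam j * s t j := fun t =>
    tsum_nonneg fun j => mul_nonneg (hl j) (hs t j)
  have hrisk : expectedExcessRisk P D wstar γ N w₀ Z =
      ENNReal.ofReal (1 / 2) * ∑' i, ENNReal.ofReal (lam i * s N i) := by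
    rw [expectedExcessRisk_eq hm hv hZ hind]
    congr 1
    refine tsum_congr fun i => ?_
    rw [ENNReal.ofReal_mul (hl i), ← hSs N le_rfl]
  have hn1 := one_le_effN hN
  refine ⟨fun K => ?_, fun β hβ hB hw => ⟨?_, fun R hR => upperRate_optSet_le hx hv hα hσ hR⟩⟩
  · have hrec : ∀ t < N, ∀ i, s (t + 1) i ≤ (1 - stepsize γ N t * lam i) ^ 2 * s t i +
        2 * stepsize γ N t ^ 2 * lam i * (α * ∑' j, lam j * s t j + σ ^ 2) := by
      intro t ht i
      have h := hup t ht i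
      have h1 := he0 t
      have h2 := hs t i
      have h3 := hl i
      rw [ofReal_recursion_eq hl hsum (hfin t ht.le) (sq_nonneg _) (by positivity) hα.le
        (sq_nonneg σ)] at h
      exact (ENNReal.ofReal_le_ofReal_iff (by positivity)).1 ((hSs (t + 1) ht i).symm.trans_le h)
    have ha : 0 ≤ 1 / (effN N * γ) := by positivity
    have hsp := summable_splitWeights hl hsum K ha (fun i => sq_nonneg _) (summable_inner_sq (v := v) u)
    have hKs : Summable fun i => splitWeights lam K (1 / (effN N * γ)) i * s 0 i := by
      simpa only [hs_def, hs0] using hsp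
    have hmain := le_of_recursion_of_first_phase hN hγ hα (sq_nonneg σ) hl hsum hτ hle1 hs hss hrec
      K hKs
    simp only [hs_def, hs0] at hmain
    set M := ∑' i, splitWeights lam K (1 / (effN N * γ)) i * inner ℝ (v i) u ^ 2 with hM
    have hM0 : 0 ≤ M := tsum_nonneg fun i =>
      mul_nonneg (splitWeights_nonneg hl K ha i) (sq_nonneg _)
    have hU : upperRate (cov D) v lam α σ γ N u K =
        ENNReal.ofReal (quad (cov D) (contraction (cov D) γ N u)) +
          ENNReal.ofReal (α * M + σ ^ 2) * (effDim lam γ N K / ENNReal.ofReal (effN N)) := by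
      rw [upperRate, specNormSq_eq (splitWeights_nonneg hl K ha) hsp, ← ENNReal.ofReal_mul hα.le,
        ← ENNReal.ofReal_add (by positivity) (by positivity)]
    rw [hrisk, hU]
    calc _ ≤ ∑' i, ENNReal.ofReal (lam i * s N i) :=
          mul_le_of_le_one_left zero_le (ENNReal.ofReal_le_one.2 (by norm_num))
      _ ≤ ∑' i, (ENNReal.ofReal (lam i * (decay γ N (lam i) 0 ^ 2 * inner ℝ (v i) u ^ 2)) +
            ENNReal.ofReal (128 * (α * M + σ ^ 2)) *
              ENNReal.ofReal (dimWeights lam γ N K i / effN N)) := by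
          refine ENNReal.tsum_le_tsum fun i => ?_
          rw [← ENNReal.ofReal_mul (by positivity)]
          exact (ENNReal.ofReal_le_ofReal (hmain i)).trans ENNReal.ofReal_add_le
      _ = ENNReal.ofReal (quad (cov D) (contraction (cov D) γ N u)) +
          ENNReal.ofReal 128 * (ENNReal.ofReal (α * M + σ ^ 2) *
            (effDim lam γ N K / ENNReal.ofReal (effN N))) := by
          rw [ENNReal.tsum_add, ENNReal.tsum_mul_left, tsum_dimWeights_div hN,
            ofReal_quad_contraction hx hv, ENNReal.ofReal_mul (by norm_num : (0 : ℝ) ≤ 128),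
            mul_assoc]
      _ ≤ _ := by
          rw [mul_add]
          gcongr
          exact le_mul_of_one_le_left zero_le (by rw [ENNReal.one_le_ofReal]; norm_num)
  · have hrec : ∀ t < N, ∀ i, (1 - stepsize γ N t * lam i) ^ 2 * s t i +
        stepsize γ N t ^ 2 * lam i * (β * ∑' j, lam j * s t j + σ ^ 2) ≤ s (t + 1) i := by
      intro t ht i
      have h := le_secondMoment_sgd_succ hm hn hw hv hβ.le hB hZ hind γ w₀ ht i
      have h3 := hl i
      rw [ofReal_recursion_eq hl hsum (hfin t ht.le) (sq_nonneg _) (by positivity) hβ.le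
        (sq_nonneg σ)] at h
      exact (ENNReal.ofReal_le_ofReal_iff (hs _ _)).1 (h.trans_eq (hSs (t + 1) ht i))
    have hsp := summable_splitWeights hl hsum (optSet lam γ N) le_rfl (fun i => sq_nonneg _)
      (summable_inner_sq (v := v) u)
    have hmain := ge_of_recursion_optSet hN hγ hβ.le (sq_nonneg σ) hl hsum hle hs hss hrec
    simp only [hs_def, hs0] at hmain
    set M := ∑' i, splitWeights lam (optSet lam γ N) 0 i * inner ℝ (v i) u ^ 2 with hM
    have hM0 : 0 ≤ M := tsum_nonneg fun i =>
      mul_nonneg (splitWeights_nonneg hl _ le_rfl i) (sq_nonneg _)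
    have hLr : lowerRate (cov D) v lam β σ γ N u (optSet lam γ N) =
        ENNReal.ofReal (quad (cov D) (contraction (cov D) γ N u)) +
          ENNReal.ofReal (β * M + σ ^ 2) *
            (effDim lam γ N (optSet lam γ N) / ENNReal.ofReal (effN N)) := by
      rw [lowerRate, specNormSq_eq (splitWeights_nonneg hl _ le_rfl) hsp,
        ← ENNReal.ofReal_mul hβ.le, ← ENNReal.ofReal_add (by positivity) (by positivity)]
    have hc1 : Real.exp (-32) / 32 ≤ 1 := by
      have : Real.exp (-32) ≤ 1 := Real.exp_le_one_iff.2 (by norm_num)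
      linarith
    rw [hrisk, hLr, ENNReal.ofReal_mul (by norm_num), mul_assoc]
    gcongr
    calc _ ≤ ENNReal.ofReal (quad (cov D) (contraction (cov D) γ N u)) +
          ENNReal.ofReal (Real.exp (-32) / 32) * (ENNReal.ofReal (β * M + σ ^ 2) *
            (effDim lam γ N (optSet lam γ N) / ENNReal.ofReal (effN N))) := by
          rw [mul_add]
          gcongr
          exact mul_le_of_le_one_left zero_le (ENNReal.ofReal_le_one.2 hc1)
      _ = ∑' i, (ENNReal.ofReal (lam i * (decay γ N (lam i) 0 ^ 2 * inner ℝ (v i) u ^ 2)) +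
            ENNReal.ofReal (Real.exp (-32) / 32 * (β * M + σ ^ 2)) *
              ENNReal.ofReal (dimWeights lam γ N (optSet lam γ N) i / effN N)) := by
          rw [ENNReal.tsum_add, ENNReal.tsum_mul_left, tsum_dimWeights_div hN,
            ofReal_quad_contraction hx hv, ENNReal.ofReal_mul (by positivity), mul_assoc]
      _ ≤ ∑' i, ENNReal.ofReal (lam i * s N i) := by
          refine ENNReal.tsum_le_tsum fun i => ?_
          have h1 := hl i
          have h2 := dimWeights_nonneg (lam := lam) (γ := γ) (N := N) (optSet lam γ N) i
          rw [← ENNReal.ofReal_mul (by positivity),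
            ← ENNReal.ofReal_add (by positivity) (by positivity)]
          exact ENNReal.ofReal_le_ofReal (hmain i)
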